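/- Let $G=(X\,\dot\cup\,Y,E)$ be a finite bipartite graph with $m=|E|$ edges, and let $\underline n=\min(|X|,|Y|)$. For $A\subseteq X$ and $B\subseteq Y$, let $G[A,B]$ be the subgraph of $G$ induced by $A\cup B$. Call $G[A,B]$ *$X$-saturated* if it has a matching that saturates every vertex of $A$. Call $G[A,B]$ *$Y$-path-saturated* if for some $k\ge 1$ there are partitions $A=A_0\,\dot\cup\cdots\dot\cup\,A_k$ and $B=B_1\,\dot\cup\cdots\dot\cup\,B_k$ (blocks may be empty) such that, for every $i\in\{1,\dots,k\}$, there is a perfect matching between $A_i$ and $B_i$, and every vertex of $B_i$ is adjacent to some vertex of $A_{i-1}$. A matching $M$ of $G$ is *envy-free* if no vertex of $X$ that is unsaturated by $M$ is adjacent in $G$ to a vertex of $Y$ that is saturated by $M$. There are unique partitions $X=X_S\,\dot\cup\,X_L$ and $Y=Y_S\,\dot\cup\,Y_L$ such that (a) there are no edges between $X_S$ and $Y_L$; (b) $G[X_S,Y_S]$ is $Y$-path-saturated; (c) $G[X_L,Y_L]$ is $X$-saturated. Moreover: (d) $G[X_L,Y_L]$ admits a matching saturating $X_L$, and every such matching is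 envy-free in $G$; (e) every envy-free matching of $G$ is contained in $G[X_L,Y_L]$. These partitions can be computed in $O(m\sqrt{\underline n})$ time: there are a fixed program for a unit-cost random access machine (finitely many registers and arrays of natural numbers; arithmetic operations $+1$ and $-1$, comparisons, branching and loops) and a constant $C$ such that, for every finite bipartite graph $G$, given $|X|$, $|Y|$, $m$ and a list of the edges of $G$ in any order, the vertices of each side being numbered $0,1,2,\dots$ in any way (all other memory being zero), the program halts within $C\,(m\sqrt{\underline n}+1)$ steps, with the indicator functions of $X_L$ in $X$ and of $Y_S$ in $Y$ stored in two arrays. -/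

import Mathlib

namespace EnvyFree

/-! ### Matchings in bipartite graphs -/

section Graph

variable {V : Type*}

/-- `G` is a bipartite graph with sides `X` and `Y`: the vertex set is the disjoint union of `X`
and `Y`, and every edge joins a vertex of `X` to a vertex of `Y`. -/
structure IsBipartition (G : SimpleGraph V) (X Y : Set V) : Prop where
  isBipartiteWith : G.IsBipartiteWith X Y
  union_eq : X ∪ Y = Set.univ

/-- `G[A, B]`, the subgraph of `G` induced by the vertices `A ∪ B`. -/
def between (G : SimpleGraph V) (A B : Set V) : G.Subgraph :=
  (⊤ : G.Subgraph).induce (A ∪ B)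

/-- `M` is a matching of `G` that is envy-free with respect to `X`: no vertex of `X` that `M` leaves
unsaturated is adjacent in `G` to a vertex of `Y` that `M` saturates. (The vertices of a subgraph
with `IsMatching` are exactly the vertices that the matching saturates.) -/
def IsEnvyFreeMatching (G : SimpleGraph V) (X Y : Set V) (M : G.Subgraph) : Prop :=
  M.IsMatching ∧ ∀ x ∈ X \ M.verts, ∀ y ∈ Y ∩ M.verts, ¬ G.Adj x y

/-- `M` is a matching of `G[A, B]` that saturates `A`. -/
def IsSaturatingMatching (G : SimpleGraph V) (A B : Set V) (M : G.Subgraph) : Prop :=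
  M.IsMatching ∧ M ≤ between G A B ∧ A ⊆ M.verts

/-- For `A ⊆ X` and `B ⊆ Y`: the graph `G[A, B]` is `X`-saturated. -/
def IsXSaturated (G : SimpleGraph V) (A B : Set V) : Prop :=
  ∃ M : G.Subgraph, IsSaturatingMatching G A B M

/-- For `A ⊆ X` and `B ⊆ Y`: the graph `G[A, B]` is `Y`-path-saturated. The blocks
`A₀, …, A_k` are `P 0, …, P k` and the blocks `B₁, …, B_k` are `Q 0, …, Q (k - 1)`; thus, for
`i : Fin k`, the set `Q i` is the block `B_{i+1}`, while `P i.succ` is `A_{i+1}` and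
`P i.castSucc` is `A_i`. Blocks may be empty. -/
def IsYPathSaturated (G : SimpleGraph V) (A B : Set V) : Prop :=
  ∃ k : ℕ, 1 ≤ k ∧ ∃ (P : Fin (k + 1) → Set V) (Q : Fin k → Set V),
    (⋃ i, P i) = A ∧ Pairwise (fun i j => Disjoint (P i) (P j)) ∧
    (⋃ i, Q i) = B ∧ Pairwise (fun i j => Disjoint (Q i) (Q j)) ∧
    ∀ i : Fin k,
      (∃ M : G.Subgraph, M.IsMatching ∧ M.verts = P i.succ ∪ Q i) ∧
      ∀ y ∈ Q i, ∃ x ∈ P i.castSucc, G.Adj x y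

/-- Four sets of vertices `X_S`, `X_L`, `Y_S`, `Y_L`. -/
@[ext]
structure Parts (V : Type*) where
  XS : Set V
  XL : Set V
  YS : Set V
  YL : Set V

/-- `X = X_S ∪ X_L` and `Y = Y_S ∪ Y_L` are partitions, and
(a) no edge joins `X_S` to `Y_L`;
(b) `G[X_S, Y_S]` is `Y`-path-saturated;
(c) `G[X_L, Y_L]` is `X`-saturated. -/
structure IsStructurePartition (G : SimpleGraph V) (X Y : Set V) (p : Parts V) : Prop where
  X_union : p.XS ∪ p.XL = X
  X_disjoint : Disjoint p.XS p.XL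
  Y_union : p.YS ∪ p.YL = Y
  Y_disjoint : Disjoint p.YS p.YL
  no_edge : ∀ x ∈ p.XS, ∀ y ∈ p.YL, ¬ G.Adj x y
  pathSaturated : IsYPathSaturated G p.XS p.YS
  saturated : IsXSaturated G p.XL p.YL

end Graph

/-! ### A random access machine with a step count

A program works on registers and on arrays, which hold natural numbers. It is a finite piece of
code that names its registers and arrays by literals, so it uses only finitely many of them.
The arithmetic is that of a successor machine (constants, `+ 1`, `- 1`, comparison), so that a unit
of time raises the largest number in store by at most one, up to the constants in the program, and
unit cost cannot be abused by building long numbers. -/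

/-- A state: the contents of the registers and of the cells of the arrays. -/
structure State where
  reg : ℕ → ℕ
  arr : ℕ → ℕ → ℕ

/-- Expressions: a constant, a register, a cell of array `a`, successor, truncated predecessor. -/
inductive Expr where
  | lit (n : ℕ)
  | reg (r : ℕ)
  | cell (a : ℕ) (index : Expr)
  | succ (e : Expr)
  | pred (e : Expr)

/-- The value of an expression. -/
def Expr.val (s : State) : Expr → ℕ
  | lit n => n
  | reg r => s.reg r
  | cell a e => s.arr a (e.val s)
  | succ e => e.val s + 1
  | pred e => e.val s - 1

/-- The cost of an expression: one per operation. -/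
def Expr.cost : Expr → ℕ
  | lit _ => 1
  | reg _ => 1
  | cell _ e => e.cost + 1
  | succ e => e.cost + 1
  | pred e => e.cost + 1

/-- Tests. -/
inductive Test where
  | eq (e f : Expr)
  | lt (e f : Expr)
  | neg (b : Test)
  | conj (b c : Test)

/-- The truth value of a test. -/
def Test.Holds (s : State) : Test → Prop
  | eq e f => e.val s = f.val s
  | lt e f => e.val s < f.val s
  | neg b => ¬ b.Holds s
  | conj b c => b.Holds s ∧ c.Holds s

/-- The cost of a test: one per operation. -/
def Test.cost : Test → ℕ
  | eq e f => e.cost + f.cost + 1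
  | lt e f => e.cost + f.cost + 1
  | neg b => b.cost + 1
  | conj b c => b.cost + c.cost + 1

/-- Programs. -/
inductive Program where
  | skip
  | assign (r : ℕ) (e : Expr)
  | store (a : ℕ) (index e : Expr)
  | seq (c d : Program)
  | cond (b : Test) (c d : Program)
  | loop (b : Test) (c : Program)

/-- Assign `v` to register `r`. -/
def State.setReg (s : State) (r v : ℕ) : State :=
  { s with reg := Function.update s.reg r v }

/-- Write `v` into cell `i` of array `a`. -/
def State.setCell (s : State) (a i v : ℕ) : State :=
  { s with arr := Function.update s.arr a (Function.update (s.arr a) i v) }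

/-- `Runs c s t s'`: started in state `s`, the program `c` halts in state `s'` after exactly `t`
steps. `cond b c d` is `if b then c else d`, and `loop b c` is `while b do c`. -/
inductive Runs : Program → State → ℕ → State → Prop where
  | skip (s : State) : Runs Program.skip s 1 s
  | assign (s : State) (r : ℕ) (e : Expr) :
      Runs (Program.assign r e) s (e.cost + 1) (s.setReg r (e.val s))
  | store (s : State) (a : ℕ) (i e : Expr) :
      Runs (Program.store a i e) s (i.cost + e.cost + 1) (s.setCell a (i.val s) (e.val s))
  | seq {c d : Program} {s s' s'' : State} {t t' : ℕ} :
      Runs c s t s' → Runs d s' t' s'' → Runs (Program.seq c d) s (t + t') s''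
  | cond_true {b : Test} {c d : Program} {s s' : State} {t : ℕ} :
      b.Holds s → Runs c s t s' → Runs (Program.cond b c d) s (b.cost + 1 + t) s'
  | cond_false {b : Test} {c d : Program} {s s' : State} {t : ℕ} :
      ¬ b.Holds s → Runs d s t s' → Runs (Program.cond b c d) s (b.cost + 1 + t) s'
  | loop_true {b : Test} {c : Program} {s s' s'' : State} {t t' : ℕ} :
      b.Holds s → Runs c s t s' → Runs (Program.loop b c) s' t' s'' →
        Runs (Program.loop b c) s (b.cost + 1 + t + t') s''
  | loop_false {b : Test} {c : Program} {s : State} :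
      ¬ b.Holds s → Runs (Program.loop b c) s (b.cost + 1) s

/-! ### Input and output of graph algorithms -/

section Input

variable {V : Type*}

/-- A presentation of a bipartite graph to a program: the vertices of either side are numbered
`0, 1, 2, …`, and the edges are listed in some order, each of them once. -/
structure EdgeListing (G : SimpleGraph V) (X Y : Set V) where
  numX : X ≃ Fin X.ncard
  numY : Y ≃ Fin Y.ncard
  edges : List (X × Y)
  nodup : edges.Nodup
  mem_edges : ∀ (x : X) (y : Y), (x, y) ∈ edges ↔ G.Adj x y

/-- The state in which a program starts: registers `0`, `1`, `2` hold `|X|`, `|Y|` and the number of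
edges; cell `i` of array `0` and cell `i` of array `1` hold the numbers of the ends in `X` and in
`Y` of the `i`-th edge, counted from `0`; everything else is zero. -/
noncomputable def EdgeListing.initial {G : SimpleGraph V} {X Y : Set V} (I : EdgeListing G X Y) : State where
  reg r := if r = 0 then X.ncard else if r = 1 then Y.ncard
    else if r = 2 then I.edges.length else 0
  arr a i := match I.edges[i]? with
    | none => 0
    | some e => if a = 0 then (I.numX e.1 : ℕ) else if a = 1 then (I.numY e.2 : ℕ) else 0

/-- The state `s` exhibits the partitions `p`: array `2` is the indicator of `X_L` inside `X`, and
array `3` is the indicator of `Y_S` inside `Y`. -/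
def EdgeListing.Exhibits {G : SimpleGraph V} {X Y : Set V} (I : EdgeListing G X Y)
    (s : State) (p : Parts V) : Prop :=
  (∀ x : X, ((x : V) ∈ p.XL → s.arr 2 (I.numX x) = 1) ∧
    ((x : V) ∈ p.XS → s.arr 2 (I.numX x) = 0)) ∧
  (∀ y : Y, ((y : V) ∈ p.YS → s.arr 3 (I.numY y) = 1) ∧
    ((y : V) ∈ p.YL → s.arr 3 (I.numY y) = 0))

end Input

end EnvyFree

/-!
Given a matching, let `X_S` and `Y_S` be the sets of vertices that can be reached from the unmatched
vertices of `X` (and the isolated ones) by alternating paths. If no unmatched vertex of `Y` is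
reached, then these sets form the partition: no edge leaves `X_S` for `Y_L`, the depth in a search
forest gives the blocks of a path-saturation (`isYPathSaturated_of_depth`), and every vertex of
`X_L` is matched, into `Y_L` (`Closed.exists_partition`). So existence follows from an algorithm
that ends with such a matching.

An envy-free matching `M` avoids `X_S ∪ Y_S`, by counting (`IsEnvyFreeMatching.disjoint`): `M` maps
the saturated vertices of `X_S` injectively to those of `Y_S`, and the matchings between the blocks
map the latter injectively to the former; so both maps are bijections, but a saturated vertex of
`Y_S` in the first possible block has a neighbour in the preceding block of `X`, which must be
saturated too and is not in the image. Hence the `X_L` of one partition, which is saturated by an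
envy-free matching, is contained in the `X_L` of any other one, and `Y_S` is the neighbourhood of
`X_S`; this gives uniqueness.

The algorithm finds most of the matching by an auction (`Auction`), in place of the phases of
Hopcroft and Karp. Every `y` has a price, every `x` a level; an unmatched `x` runs through its list
of edges, takes a `y` whose price is below its level, at the price of its level, even if `y` is
matched, and raises its level at the end of the list. A vertex whose level is `K` gives up at the
end of its list. This takes `O(m K)` steps, and by a family of vertex covers, one for each price,
the matching `M` that results satisfies `K |M'| ≤ (K + 1) |M|` for every matching `M'`
(`Auction.mul_card_le`). Let `n` be the least of `m`, `|X|` and `|Y|`; for `K ≈ √(2 n)`, at most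
`K + 1` augmenting paths remain to be found, each by a search that takes `O(m)` steps (`Search`,
`Flip`). The last search, which fails, yields the partition. The bound `m` on `n` lets the program
compute `K` by counting within the time limit.

The adjacency lists are linked lists of decreasing edge numbers, so that the rest of a list is
described by a pointer alone (`Lists`). Programs are verified by rules for total correctness with a
potential that pays for the steps of the loops (`wp_loop`).
-/

namespace EnvyFree

/-! ### Total correctness with time -/

/-- `WP c s Q`: started in `s`, the program `c` halts after some number `t` of steps in a state `s'`
with `Q t s'`. -/
def WP (c : Program) (s : State) (Q : ℕ → State → Prop) : Prop :=
  ∃ t s', Runs c s t s' ∧ Q t s'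

infixr:60 " ;; " => Program.seq

namespace State

variable (s : State) (r r' a b i v : ℕ)

@[simp] theorem reg_setReg : (s.setReg r v).reg r' = if r' = r then v else s.reg r' := by
  simp [setReg, Function.update_apply]

@[simp] theorem arr_setReg : (s.setReg r v).arr = s.arr := rfl

@[simp] theorem reg_setCell : (s.setCell a i v).reg = s.reg := rfl

@[simp] theorem arr_setCell :
    (s.setCell a i v).arr b = if b = a then Function.update (s.arr a) i v else s.arr b := by
  simp only [setCell, Function.update_apply]

end State

attribute [simp] Expr.val Expr.cost Test.Holds Test.cost

theorem WP.mono {c : Program} {s : State} {Q Q' : ℕ → State → Prop} (h : WP c s Q)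
    (hQ : ∀ t s', Q t s' → Q' t s') : WP c s Q' := by
  obtain ⟨t, s', hr, hq⟩ := h
  exact ⟨t, s', hr, hQ _ _ hq⟩

theorem wp_skip {s : State} {Q : ℕ → State → Prop} (h : Q 1 s) : WP .skip s Q :=
  ⟨_, _, .skip s, h⟩

theorem wp_assign {s : State} {Q : ℕ → State → Prop} {r : ℕ} {e : Expr}
    (h : Q (e.cost + 1) (s.setReg r (e.val s))) : WP (.assign r e) s Q :=
  ⟨_, _, .assign s r e, h⟩

theorem wp_store {s : State} {Q : ℕ → State → Prop} {a : ℕ} {i e : Expr}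
    (h : Q (i.cost + e.cost + 1) (s.setCell a (i.val s) (e.val s))) : WP (.store a i e) s Q :=
  ⟨_, _, .store s a i e, h⟩

theorem wp_seq {c d : Program} {s : State} {Q : ℕ → State → Prop}
    (h : WP c s fun t s' => WP d s' fun t' s'' => Q (t + t') s'') : WP (c ;; d) s Q := by
  obtain ⟨t, s', hc, t', s'', hd, hq⟩ := h
  exact ⟨_, _, .seq hc hd, hq⟩

theorem wp_cond {b : Test} {c d : Program} {s : State} {Q : ℕ → State → Prop}
    (hc : b.Holds s → WP c s fun t => Q (b.cost + 1 + t))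
    (hd : ¬ b.Holds s → WP d s fun t => Q (b.cost + 1 + t)) : WP (.cond b c d) s Q := by
  by_cases hb : b.Holds s
  · obtain ⟨t, s', h, hq⟩ := hc hb
    exact ⟨_, _, .cond_true hb h, hq⟩
  · obtain ⟨t, s', h, hq⟩ := hd hb
    exact ⟨_, _, .cond_false hb h, hq⟩

/-- The rule for loops: an invariant `I`, and a potential `φ` that pays for every iteration. -/
theorem wp_loop {b : Test} {c : Program} (I : State → Prop) (φ : State → ℕ)
    (hstep : ∀ s, I s → b.Holds s →
      WP c s fun t s' => I s' ∧ b.cost + 1 + t + φ s' ≤ φ s) {s : State} (hs : I s) :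
    WP (.loop b c) s fun t s' => I s' ∧ ¬ b.Holds s' ∧ t + φ s' ≤ φ s + b.cost + 1 := by
  induction hn : φ s using Nat.strong_induction_on generalizing s with
  | _ n ih =>
    subst hn
    by_cases hb : b.Holds s
    · obtain ⟨t, s', hr, hI, ht⟩ := hstep s hs hb
      obtain ⟨t', s'', hr', hI', hb', ht'⟩ := ih (φ s') (by omega) hI rfl
      exact ⟨_, _, .loop_true hb hr hr', hI', hb', by omega⟩
    · exact ⟨_, _, .loop_false hb, hs, hb, by omega⟩

/-- Run `c` for all edges; register `4` is the number of the edge. -/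
def forEdges (c : Program) : Program :=
  .assign 4 (.lit 0) ;; .loop (.lt (.reg 4) (.reg 2)) (c ;; .assign 4 (.succ (.reg 4)))

/-- The rule for loops over the edges. The potential `φ` pays for what an iteration takes in excess
of `T` steps. -/
theorem wp_forEdges {m : ℕ} {c : Program} (I : ℕ → State → Prop) (φ : State → ℕ) (T : ℕ)
    {s : State} (hm : s.reg 2 = m) (h0 : I 0 (s.setReg 4 0)) (hφ : φ (s.setReg 4 0) ≤ φ s)
    (hstep : ∀ i < m, ∀ s, s.reg 2 = m → s.reg 4 = i → I i s → WP c s fun t s' =>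
      s'.reg 2 = m ∧ s'.reg 4 = i ∧ I (i + 1) (s'.setReg 4 (i + 1)) ∧
      t + φ (s'.setReg 4 (i + 1)) ≤ φ s + T) :
    WP (forEdges c) s fun t s' => I m s' ∧ s'.reg 2 = m ∧ t + φ s' ≤ φ s + m * (T + 7) + 6 := by
  refine wp_seq (wp_assign ?_)
  refine (wp_loop (fun s' => s'.reg 2 = m ∧ s'.reg 4 ≤ m ∧ I (s'.reg 4) s')
    (fun s' => φ s' + (m - s'.reg 4) * (T + 7)) ?_ (s := s.setReg 4 0) ?_).mono ?_
  · rintro s' ⟨h2, h4, hI⟩ hb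
    simp only [Test.Holds, Expr.val, h2] at hb
    refine wp_seq ((hstep _ hb s' h2 rfl hI).mono ?_)
    rintro t s'' ⟨g2, g4, gI, gt⟩
    refine wp_assign ?_
    simp only [Expr.val, g4]
    refine ⟨⟨by simpa using g2, by simpa using hb, by simpa using gI⟩, ?_⟩
    have : m - s'.reg 4 = (m - (s'.reg 4 + 1)) + 1 := by omega
    simp only [this, Test.cost, Expr.cost, State.reg_setReg, if_true, add_mul]
    omega
  · simpa [hm] using h0
  · rintro t s' ⟨⟨h2, h4, hI⟩, hb, ht⟩
    simp only [Test.Holds, Expr.val, h2] at hb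
    have : s'.reg 4 = m := by omega
    simp only [this, State.reg_setReg, if_true, Nat.sub_zero, Nat.sub_self, zero_mul, Test.cost,
      Expr.cost] at ht hI ⊢
    exact ⟨hI, h2, by omega⟩

/-! ### Graphs given by a list of edges -/

section Coded

/-- `x` and `y` are the ends of one of the edges `0, …, m - 1`, where `ex e` and `ey e` are the ends
of the edge `e`. -/
def Edge (m : ℕ) (ex ey : ℕ → ℕ) (x y : ℕ) : Prop := ∃ e < m, ex e = x ∧ ey e = y

/-- The vertices of `X` that are not isolated. -/
def active (m : ℕ) (ex : ℕ → ℕ) : Finset ℕ := (Finset.range m).image ex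

/-- The number of edges below `p` at the vertex `x`. -/
def rest (ex : ℕ → ℕ) (p x : ℕ) : ℕ := ((Finset.range p).filter (ex · = x)).card

/-- `hd` and `nx` encode the lists of the edges at the vertices of `X`: a pointer is `0` at the end
of a list and `e + 1` at the edge `e`. The lists are decreasing, so that what remains of the list
of `x` from a pointer `p` on are the edges `e < p` at `x`. -/
structure Lists (m : ℕ) (ex hd nx : ℕ → ℕ) : Prop where
  head_le : ∀ x, hd x ≤ m
  head_pos : ∀ x p, hd x = p + 1 → ex p = x
  head_max : ∀ e < m, e < hd (ex e)
  next_le : ∀ e < m, nx e ≤ e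
  next_pos : ∀ e < m, ∀ p, nx e = p + 1 → ex p = ex e
  next_max : ∀ e < m, ∀ e' < e, ex e' = ex e → e' < nx e

/-- `mX` and `mY` encode a matching: `mX x` is `y + 1` and `mY y` is `x + 1` if `x` and `y` are
matched, and they are `0` at unmatched vertices. -/
structure Mates (m : ℕ) (ex ey mX mY : ℕ → ℕ) : Prop where
  iff : ∀ x y, mX x = y + 1 ↔ mY y = x + 1
  edge : ∀ x y, mX x = y + 1 → Edge m ex ey x y

/-- The matched vertices of `X`. -/
def matched (m : ℕ) (ex mX : ℕ → ℕ) : Finset ℕ := (active m ex).filter (mX · ≠ 0)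

variable {m : ℕ} {ex ey hd nx mX mY : ℕ → ℕ}

theorem mem_active {x : ℕ} : x ∈ active m ex ↔ ∃ e < m, ex e = x := by
  simp [active]

theorem card_active_le : (active m ex).card ≤ m :=
  Finset.card_image_le.trans (Finset.card_range m).le

theorem sum_rest : ∑ x ∈ active m ex, rest ex m x = m := by
  have := Finset.card_eq_sum_card_image ex (Finset.range m)
  rw [Finset.card_range] at this
  exact this.symm

@[simp] theorem rest_zero (x : ℕ) : rest ex 0 x = 0 := by simp [rest]

theorem rest_mono {p q : ℕ} (h : p ≤ q) (x : ℕ) : rest ex p x ≤ rest ex q x :=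
  Finset.card_le_card (Finset.filter_subset_filter _ (Finset.range_mono h))

theorem rest_succ {p x : ℕ} (h : ex p = x) : rest ex (p + 1) x = rest ex p x + 1 := by
  simp [rest, Finset.range_add_one, Finset.filter_insert, h]

theorem Lists.rest_next_lt (hL : Lists m ex hd nx) {p x : ℕ} (hp : p < m) (h : ex p = x) :
    rest ex (nx p) x + 1 ≤ rest ex (p + 1) x := by
  rw [rest_succ h]
  exact Nat.succ_le_succ (rest_mono (hL.next_le p hp) x)

namespace Mates

theorem mX_inj (h : Mates m ex ey mX mY) {x x' y : ℕ} (hx : mX x = y + 1) (hx' : mX x' = y + 1) :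
    x = x' := by
  have := (h.iff _ _).1 hx
  have := (h.iff _ _).1 hx'
  omega

theorem mem_matched (h : Mates m ex ey mX mY) {x y : ℕ} (hx : mX x = y + 1) :
    x ∈ matched m ex mX := by
  obtain ⟨e, he, rfl, -⟩ := h.edge _ _ hx
  exact Finset.mem_filter.2 ⟨mem_active.2 ⟨e, he, rfl⟩, by omega⟩

/-- Matching the unmatched vertex `x` to `y`, whose previous mate, if any, becomes unmatched. -/
theorem swap (h : Mates m ex ey mX mY) {x y : ℕ} (hx : mX x = 0) (hxy : Edge m ex ey x y) :
    Mates m ex ey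
      (if mY y = 0 then Function.update mX x (y + 1)
        else Function.update (Function.update mX x (y + 1)) (mY y - 1) 0)
      (Function.update mY y (x + 1)) := by
  obtain ⟨h1, h2⟩ := h
  constructor
  · intro a b
    have := h1 a b
    have := h1 a y
    have := h1 x b
    simp only [Function.update_apply]
    split_ifs <;> simp only [Function.update_apply] <;> split_ifs <;> grind
  · intro a b
    have := h2 a b
    split_ifs <;> simp only [Function.update_apply] <;> split_ifs <;> grind

/-- A matching is no larger than either side. -/
theorem card_matched_le (h : Mates m ex ey mX mY) {nX nY : ℕ} (hX : ∀ e < m, ex e < nX)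
    (hY : ∀ e < m, ey e < nY) : (matched m ex mX).card ≤ min m (min nX nY) := by
  refine le_min ((Finset.card_filter_le _ _).trans card_active_le) (le_min ?_ ?_)
  · rw [← Finset.card_range nX]
    refine Finset.card_le_card fun x hx => ?_
    obtain ⟨e, he, rfl⟩ := mem_active.1 (Finset.mem_filter.1 hx).1
    exact Finset.mem_range.2 (hX e he)
  · rw [← Finset.card_range nY]
    refine Finset.card_le_card_of_injOn (fun x => mX x - 1) (fun x hx => ?_)
      fun x hx x' hx' he => ?_
    · obtain ⟨y, hy⟩ := Nat.exists_eq_succ_of_ne_zero (Finset.mem_filter.1 hx).2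
      obtain ⟨e, he, -, rfl⟩ := h.edge _ _ hy
      simpa [hy] using hY e he
    · have h1 := (Finset.mem_filter.1 hx).2
      have h2 := (Finset.mem_filter.1 hx').2
      simp only at he
      exact h.mX_inj (y := mX x - 1) (by omega) (by omega)

end Mates

/-! ### The auction -/

/-- The invariant of the auction. Every `y` has a price `pr y`, every `x` a level `lab x ≤ K`, and
`x` has offered `lab x` to those `y` that come before the pointer `pt x` in its list of edges. The
vertices of `X` at the edges `e < i` have been treated; `c` is `x + 1` if `x` is bidding and `0`
if no vertex is. A matched `y` has been sold at the level of its mate. -/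
structure Auction (m : ℕ) (ex ey : ℕ → ℕ) (K i c : ℕ) (mX mY lab pr pt : ℕ → ℕ) : Prop where
  mates : Mates m ex ey mX mY
  lab_le : ∀ x, lab x ≤ K
  ptr_le : ∀ x, pt x ≤ m
  ptr_pos : ∀ x p, pt x = p + 1 → ex p = x
  price_pos : ∀ y, pr y ≠ 0 → mY y ≠ 0
  price_mate : ∀ x y, mX x = y + 1 → pr y = lab x
  price_ge : ∀ e < m, lab (ex e) ≤ pr (ey e) + 1
  price_passed : ∀ e < m, pt (ex e) ≤ e → lab (ex e) ≤ pr (ey e)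
  done : ∀ e < i, mX (ex e) ≠ 0 ∨ c = ex e + 1 ∨ (lab (ex e) = K ∧ pt (ex e) = 0)
  cur : ∀ x, c = x + 1 → mX x = 0 ∧ x ∈ active m ex

/-- The number of steps that the auction can still take. -/
def auctionPot (m : ℕ) (ex : ℕ → ℕ) (K : ℕ) (lab pt : ℕ → ℕ) : ℕ :=
  ∑ x ∈ active m ex, ((K - lab x) * (rest ex m x + 1) + rest ex (pt x) x)

variable {K i c : ℕ} {lab pr pt : ℕ → ℕ}

theorem auctionPot_zero : auctionPot m ex K (fun _ => 0) (fun _ => 0) ≤ 2 * (m * K) := by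
  simp only [auctionPot, Nat.sub_zero, rest_zero, add_zero, ← Finset.mul_sum,
    Finset.sum_add_distrib, sum_rest, Finset.sum_const, smul_eq_mul, mul_one]
  nlinarith [card_active_le (m := m) (ex := ex)]

theorem auctionPot_lt {x : ℕ} {lab' pt' : ℕ → ℕ} (hx : x ∈ active m ex)
    (hl : ∀ z, z ≠ x → lab' z = lab z) (hp : ∀ z, z ≠ x → pt' z = pt z)
    (h : (K - lab' x) * (rest ex m x + 1) + rest ex (pt' x) x <
      (K - lab x) * (rest ex m x + 1) + rest ex (pt x) x) :
    auctionPot m ex K lab' pt' + 1 ≤ auctionPot m ex K lab pt := by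
  refine Nat.succ_le_of_lt (Finset.sum_lt_sum (fun z _ => ?_) ⟨x, hx, h⟩)
  by_cases hz : z = x
  · subst hz; exact h.le
  · rw [hl z hz, hp z hz]

namespace Auction

theorem init : Auction m ex ey K 0 0 (fun _ => 0) (fun _ => 0) (fun _ => 0) (fun _ => 0)
    (fun _ => 0) := by
  have : Mates m ex ey (fun _ => 0) (fun _ => 0) := by constructor <;> simp
  constructor <;> first | exact this | simp

theorem start (h : Auction m ex ey K i 0 mX mY lab pr pt) (hi : i < m) (hx : mX (ex i) = 0) :
    Auction m ex ey K (i + 1) (ex i + 1) mX mY lab pr pt := by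
  obtain ⟨h1, h2, h3, h4, h5, h6, h7, h8, h9, h10⟩ := h
  refine ⟨h1, h2, h3, h4, h5, h6, h7, h8, ?_, ?_⟩
  · intro e he
    rcases Nat.lt_succ_iff_lt_or_eq.1 he with he | rfl
    · have := h9 e he; grind
    · simp
  · intro x hxx
    obtain rfl : ex i = x := by omega
    exact ⟨hx, mem_active.2 ⟨i, hi, rfl⟩⟩

theorem skip (h : Auction m ex ey K i 0 mX mY lab pr pt) (hx : mX (ex i) ≠ 0) :
    Auction m ex ey K (i + 1) 0 mX mY lab pr pt := by
  obtain ⟨h1, h2, h3, h4, h5, h6, h7, h8, h9, h10⟩ := h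
  refine ⟨h1, h2, h3, h4, h5, h6, h7, h8, ?_, h10⟩
  intro e he
  rcases Nat.lt_succ_iff_lt_or_eq.1 he with he | rfl
  · exact h9 e he
  · exact .inl hx

theorem raise (hL : Lists m ex hd nx) {x : ℕ} (h : Auction m ex ey K i (x + 1) mX mY lab pr pt)
    (hp : pt x = 0) (hl : lab x < K) :
    Auction m ex ey K i (x + 1) mX mY (Function.update lab x (lab x + 1)) pr
      (Function.update pt x (hd x)) ∧
    auctionPot m ex K (Function.update lab x (lab x + 1)) (Function.update pt x (hd x)) + 1 ≤
      auctionPot m ex K lab pt := by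
  obtain ⟨h1, h2, h3, h4, h5, h6, h7, h8, h9, h10⟩ := h
  have hx := h10 x rfl
  refine ⟨⟨h1, ?_, ?_, ?_, h5, ?_, ?_, ?_, ?_, h10⟩, ?_⟩
  · intro z; simp only [Function.update_apply]; split_ifs <;> grind
  · intro z; have := hL.head_le x; simp only [Function.update_apply]; split_ifs <;> grind
  · intro z p; have := hL.head_pos x; simp only [Function.update_apply]; split_ifs <;> grind
  · intro z y; simp only [Function.update_apply]; split_ifs <;> grind
  · intro e he; have := h8 e he; simp only [Function.update_apply]; split_ifs <;> grind
  · intro e he; have := h8 e he; have := hL.head_max e he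
    simp only [Function.update_apply]; split_ifs <;> grind
  · intro e he; have := h9 e he; simp only [Function.update_apply]; split_ifs <;> grind
  · refine auctionPot_lt hx.2 (fun z hz => by simp [hz]) (fun z hz => by simp [hz]) ?_
    have e1 : K - lab x = (K - (lab x + 1)) + 1 := by omega
    have := rest_mono (ex := ex) (hL.head_le x) x
    simp only [Function.update_self, e1, hp, rest_zero, add_mul]
    omega

theorem drop {x : ℕ} (h : Auction m ex ey K i (x + 1) mX mY lab pr pt)
    (hp : pt x = 0) (hl : ¬ lab x < K) : Auction m ex ey K i 0 mX mY lab pr pt := by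
  obtain ⟨h1, h2, h3, h4, h5, h6, h7, h8, h9, h10⟩ := h
  refine ⟨h1, h2, h3, h4, h5, h6, h7, h8, ?_, by simp⟩
  intro e he
  have := h9 e he
  have := h2 x
  grind

theorem pass (hL : Lists m ex hd nx) {x p : ℕ}
    (h : Auction m ex ey K i (x + 1) mX mY lab pr pt) (hp : pt x = p + 1)
    (hl : ¬ pr (ey p) < lab x) :
    Auction m ex ey K i (x + 1) mX mY lab pr (Function.update pt x (nx p)) ∧
    auctionPot m ex K lab (Function.update pt x (nx p)) + 1 ≤ auctionPot m ex K lab pt := by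
  obtain ⟨h1, h2, h3, h4, h5, h6, h7, h8, h9, h10⟩ := h
  have hx := h10 x rfl
  have hpm : p < m := by have := h3 x; omega
  have hxp := h4 x p hp
  have hn := hL.next_le p hpm
  refine ⟨⟨h1, h2, ?_, ?_, h5, h6, h7, ?_, ?_, h10⟩, ?_⟩
  · intro z; simp only [Function.update_apply]; split_ifs <;> grind
  · intro z q; have := hL.next_pos p hpm q
    simp only [Function.update_apply]; split_ifs <;> grind
  · intro e he
    have := h8 e he
    have := hL.next_max p hpm e
    simp only [Function.update_apply]; split_ifs <;> grind
  · intro e he; have := h9 e he; simp only [Function.update_apply]; split_ifs <;> grind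
  · refine auctionPot_lt hx.2 (fun z hz => rfl) (fun z hz => by simp [hz]) ?_
    have := hL.rest_next_lt hpm hxp
    simp only [Function.update_self, hp]
    omega

theorem take (hL : Lists m ex hd nx) {x p : ℕ}
    (h : Auction m ex ey K i (x + 1) mX mY lab pr pt) (hp : pt x = p + 1)
    (hl : pr (ey p) < lab x) :
    Auction m ex ey K i (mY (ey p))
      (if mY (ey p) = 0 then Function.update mX x (ey p + 1)
        else Function.update (Function.update mX x (ey p + 1)) (mY (ey p) - 1) 0)
      (Function.update mY (ey p) (x + 1)) lab (Function.update pr (ey p) (lab x))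
      (Function.update pt x (nx p)) ∧
    auctionPot m ex K lab (Function.update pt x (nx p)) + 1 ≤ auctionPot m ex K lab pt := by
  obtain ⟨h1, h2, h3, h4, h5, h6, h7, h8, h9, h10⟩ := h
  have hx := h10 x rfl
  have hpm : p < m := by have := h3 x; omega
  have hxp := h4 x p hp
  have hn := hL.next_le p hpm
  have hE : Edge m ex ey x (ey p) := ⟨p, hpm, hxp, rfl⟩
  refine ⟨⟨h1.swap hx.1 hE, h2, ?_, ?_, ?_, ?_, ?_, ?_, ?_, ?_⟩, ?_⟩
  · intro z; simp only [Function.update_apply]; split_ifs <;> grind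
  · intro z q; have := hL.next_pos p hpm q
    simp only [Function.update_apply]; split_ifs <;> grind
  · intro y; simp only [Function.update_apply]; split_ifs <;> grind
  · intro z y
    have i1 := h1.iff z y
    have i2 := h6 z y
    split_ifs <;> simp only [Function.update_apply] <;> split_ifs <;> grind
  · intro e he; have := h7 e he; simp only [Function.update_apply]; split_ifs <;> grind
  · intro e he
    have := h8 e he
    have := hL.next_max p hpm e
    simp only [Function.update_apply]; split_ifs <;> grind
  · intro e he; have := h9 e he
    split_ifs <;> simp only [Function.update_apply] <;> split_ifs <;> grind
  · intro z hz
    have hzy := (h1.iff z (ey p)).2 hz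
    have hzx : z ≠ x := by rintro rfl; omega
    obtain ⟨e, he, hez, -⟩ := h1.edge _ _ hzy
    refine ⟨?_, mem_active.2 ⟨e, he, hez⟩⟩
    simp [hz]
  · refine auctionPot_lt hx.2 (fun z hz => rfl) (fun z hz => by simp [hz]) ?_
    have := hL.rest_next_lt hpm hxp
    simp only [Function.update_self, hp]
    omega

/-- At the end of the auction the matching is maximum up to one part in `K`. For `1 ≤ j ≤ K`, the
vertices of `X` with a neighbour of price less than `j` and the vertices of `Y` of price at least
`j` cover all edges. The former are matched and of level at most `j`, the mates of the latter are of
level at least `j`; so the cover exceeds the matching by at most the number of matched `x` of level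
exactly `j`, and it remains to sum over `j`. -/
theorem mul_card_le (h : Auction m ex ey K m 0 mX mY lab pr pt) {mX' mY' : ℕ → ℕ}
    (h' : Mates m ex ey mX' mY') :
    K * (matched m ex mX').card ≤ (K + 1) * (matched m ex mX).card := by
  classical
  obtain ⟨h1, h2, h3, h4, h5, h6, h7, h8, h9, h10⟩ := h
  set D := matched m ex mX with hD
  have key : ∀ j ∈ Finset.Icc 1 K,
      (matched m ex mX').card ≤ D.card + (D.filter (lab · = j)).card := by
    intro j hj
    obtain ⟨hj1, hjK⟩ := Finset.mem_Icc.1 hj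
    rw [← Finset.card_filter_add_card_filter_not (s := matched m ex mX')
      (fun x => ∃ e < m, ex e = x ∧ pr (ey e) < j)]
    have c1 : ((matched m ex mX').filter (fun x => ∃ e < m, ex e = x ∧ pr (ey e) < j)).card ≤
        (D.filter (lab · ≤ j)).card := by
      refine Finset.card_le_card fun x hx => ?_
      obtain ⟨hx, e, he, rfl, hpe⟩ := Finset.mem_filter.1 hx
      have a1 := h7 e he
      have a2 := h8 e he
      have a3 := h9 e he
      refine Finset.mem_filter.2 ⟨Finset.mem_filter.2 ⟨mem_active.2 ⟨e, he, rfl⟩, ?_⟩, by omega⟩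
      rcases a3 with a3 | a3 | a3 <;> omega
    have c2 : ((matched m ex mX').filter
        (fun x => ¬ ∃ e < m, ex e = x ∧ pr (ey e) < j)).card ≤ (D.filter (j ≤ lab ·)).card := by
      -- `x` is sent to the mate of its mate
      have key : ∀ x ∈ (matched m ex mX').filter (fun x => ¬ ∃ e < m, ex e = x ∧ pr (ey e) < j),
          ∃ y w, mX' x = y + 1 ∧ mY y = w + 1 ∧ j ≤ pr y := by
        intro x hx
        obtain ⟨hx, hne⟩ := Finset.mem_filter.1 hx
        obtain ⟨y, hy⟩ := Nat.exists_eq_succ_of_ne_zero (Finset.mem_filter.1 hx).2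
        obtain ⟨e, he, hex, rfl⟩ := h'.edge _ _ hy
        have hpj : j ≤ pr (ey e) := by
          by_contra hlt
          exact hne ⟨e, he, hex, by omega⟩
        obtain ⟨w, hw⟩ := Nat.exists_eq_succ_of_ne_zero (h5 (ey e) (by omega))
        exact ⟨_, w, hy, hw, hpj⟩
      refine Finset.card_le_card_of_injOn (fun x => mY (mX' x - 1) - 1) (fun x hx => ?_)
        fun x hx x' hx' he => ?_
      · obtain ⟨y, w, hy, hw, hpj⟩ := key x hx
        have hwy := (h1.iff w y).2 hw
        simp only [hy, Nat.add_sub_cancel, hw]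
        exact Finset.mem_filter.2 ⟨h1.mem_matched hwy, by rw [← h6 _ _ hwy]; exact hpj⟩
      · obtain ⟨y, w, hy, hw, -⟩ := key x hx
        obtain ⟨y', w', hy', hw', -⟩ := key x' hx'
        simp only [hy, Nat.add_sub_cancel, hw, hy', hw'] at he
        subst he
        have e1 := (h1.iff _ _).2 hw
        have e2 := (h1.iff _ _).2 hw'
        obtain rfl : y = y' := by omega
        exact h'.mX_inj hy hy'
    have c3 : (D.filter (lab · ≤ j)).card + (D.filter (j ≤ lab ·)).card =
        D.card + (D.filter (lab · = j)).card := by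
      rw [← Finset.card_union_add_card_inter]
      congr 2
      · ext x; simp only [Finset.mem_union, Finset.mem_filter]
        have := le_total (lab x) j; tauto
      · ext x; simp only [Finset.mem_inter, Finset.mem_filter, le_antisymm_iff]; tauto
    omega
  have hsum := Finset.sum_le_sum key
  simp only [Finset.sum_const, Nat.card_Icc, Nat.add_sub_cancel, smul_eq_mul,
    Finset.sum_add_distrib] at hsum
  have hlev : ∑ j ∈ Finset.Icc 1 K, (D.filter (lab · = j)).card ≤ D.card := by
    rw [← Finset.card_biUnion]
    · refine Finset.card_le_card fun x hx => ?_
      simp only [Finset.mem_biUnion, Finset.mem_filter] at hx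
      obtain ⟨_, _, hx, _⟩ := hx
      exact hx
    · intro a _ b _ hab
      exact Finset.disjoint_filter.2 fun x _ ha hb => hab (ha.symm.trans hb)
  linarith

end Auction

end Coded

/-! ### The search for an augmenting path -/

section Coded

/-- A forest of alternating paths. The vertices `x` with `vis x ≠ 0` and `y` with `vy y ≠ 0` have
been reached, a vertex `y` from its parent `par y`, and a matched `x` from its mate; `vis` increases
along the paths. -/
structure Forest (m : ℕ) (ex ey mX vis vy par : ℕ → ℕ) : Prop where
  active : ∀ x, vis x ≠ 0 → x ∈ active m ex
  mate : ∀ x y, vis x ≠ 0 → mX x = y + 1 → vy y ≠ 0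
  vis_par : ∀ y, vy y ≠ 0 → vis (par y) ≠ 0
  edge_par : ∀ y, vy y ≠ 0 → Edge m ex ey (par y) y
  lt : ∀ x y, vy y ≠ 0 → mX x = y + 1 → vis (par y) < vis x

/-- A forest that cannot be extended and has no unmatched vertex of `Y`: what has been reached are
the parts `X_S` and `Y_S`. -/
structure Closed (m : ℕ) (ex ey mX mY vis vy par : ℕ → ℕ) : Prop
    extends Mates m ex ey mX mY, Forest m ex ey mX vis vy par where
  root : ∀ x ∈ EnvyFree.active m ex, mX x = 0 → vis x ≠ 0
  vy_le : ∀ y, vy y ≤ 1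
  matched : ∀ y, vy y ≠ 0 → mY y ≠ 0
  closed : ∀ e < m, vis (ex e) ≠ 0 → vy (ey e) ≠ 0

/-- The queue `qu` of length `qt` lists the vertices `x` with `vis x ≠ 0`, and `vis x - 1` is the
position of `x`. -/
def IsQueue (qt : ℕ) (vis qu : ℕ → ℕ) : Prop := ∀ x i, (i < qt ∧ qu i = x) ↔ vis x = i + 1

/-- The state of the queue when the unmatched vertices among the ends of the edges `e < i` have
been put into it. -/
structure Roots (m : ℕ) (ex mX : ℕ → ℕ) (i qt : ℕ) (vis qu : ℕ → ℕ) : Prop where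
  queue : IsQueue qt vis qu
  active : ∀ x, vis x ≠ 0 → x ∈ active m ex
  unmatched : ∀ x, vis x ≠ 0 → mX x = 0
  root : ∀ e < i, mX (ex e) = 0 → vis (ex e) ≠ 0

/-- The invariant of the search. The first `qh` entries of the queue have been treated, except for
the edges `e < p` at the last one of them, `cur`. If an unmatched `y` has been reached, then `found`
is `y + 1` for such a vertex `y`. -/
structure Search (m : ℕ) (ex ey mX mY : ℕ → ℕ) (qh qt cur p found : ℕ) (vis qu vy par : ℕ → ℕ) :
    Prop extends Forest m ex ey mX vis vy par where
  queue : IsQueue qt vis qu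
  root : ∀ x ∈ EnvyFree.active m ex, mX x = 0 → vis x ≠ 0
  vy_le : ∀ y, vy y ≤ 1
  found_ne : ∀ y, vy y ≠ 0 → mY y = 0 → found ≠ 0
  found_eq : ∀ y, found = y + 1 → vy y ≠ 0 ∧ mY y = 0
  closed : ∀ e < m, vis (ex e) ≠ 0 → vis (ex e) ≤ qh → vy (ey e) = 0 → ex e = cur ∧ e < p
  ptr_le : p ≤ m
  ptr_pos : ∀ e, p = e + 1 → ex e = cur ∧ vis cur = qh ∧ qh ≠ 0
  head_le : qh ≤ qt

/-- The number of steps that the search can still take. -/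
def searchPot (m : ℕ) (ex : ℕ → ℕ) (qh cur p : ℕ) (vis : ℕ → ℕ) : ℕ :=
  ∑ x ∈ active m ex, (if vis x ≠ 0 ∧ vis x ≤ qh then 0 else rest ex m x + 1) + rest ex p cur

/-- The invariant of the flipping of an augmenting path, where `mX₀` and `mY₀` encode the matching
before that. If `c` is `y + 1`, then the vertex `y` is about to be matched to its parent; apart from
the entry at `y`, which is out of date, `mX` and `mY` encode a matching, and it still agrees with
the given one on the remaining part of the path. If `c` is `0`, then the path has been flipped. -/
structure Flip (m : ℕ) (ex ey mX₀ vis vy par : ℕ → ℕ) (c : ℕ) (mX mY : ℕ → ℕ) : Prop where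
  mates : ∀ y, c = y + 1 → Mates m ex ey mX (Function.update mY y 0)
  matched : ∀ y, c = y + 1 → matched m ex mX = matched m ex mX₀
  reached : ∀ y, c = y + 1 → vy y ≠ 0
  agree : ∀ y x, c = y + 1 → vis x ≤ vis (par y) → mX x = mX₀ x
  mates_end : c = 0 → Mates m ex ey mX mY
  card_end : c = 0 → (EnvyFree.matched m ex mX).card = (EnvyFree.matched m ex mX₀).card + 1

variable {m : ℕ} {ex ey hd nx mX mY : ℕ → ℕ}
variable {i qh qt cur p found : ℕ} {vis qu vy par : ℕ → ℕ}

theorem IsQueue.push (h : IsQueue qt vis qu) {w : ℕ} (hw : vis w = 0) :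
    IsQueue (qt + 1) (Function.update vis w (qt + 1)) (Function.update qu qt w) := by
  intro x i
  have h1 := h x i
  have h2 := h w i
  simp only [Function.update_apply]
  split_ifs <;> grind

theorem IsQueue.vis_le (h : IsQueue qt vis qu) (x : ℕ) : vis x ≤ qt := by
  rcases Nat.eq_zero_or_pos (vis x) with h0 | h0
  · omega
  · have := ((h x (vis x - 1)).2 (by omega)).1
    omega

namespace Roots

theorem init : Roots m ex mX 0 0 (fun _ => 0) qu := by
  constructor <;> simp [IsQueue]

theorem push (h : Roots m ex mX i qt vis qu) (hi : i < m) (hx : mX (ex i) = 0)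
    (hv : vis (ex i) = 0) :
    Roots m ex mX (i + 1) (qt + 1) (Function.update vis (ex i) (qt + 1))
      (Function.update qu qt (ex i)) := by
  obtain ⟨h1, h2, h3, h4⟩ := h
  refine ⟨h1.push hv, fun x => ?_, fun x => ?_, fun e he => ?_⟩
  · have : ex i ∈ EnvyFree.active m ex := mem_active.2 ⟨i, hi, rfl⟩
    simp only [Function.update_apply]; split_ifs <;> grind
  · simp only [Function.update_apply]; split_ifs <;> grind
  · have : e < i ∨ e = i := by omega
    simp only [Function.update_apply]; split_ifs <;> grind

theorem skip (h : Roots m ex mX i qt vis qu) (hv : ¬ (mX (ex i) = 0 ∧ vis (ex i) = 0)) :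
    Roots m ex mX (i + 1) qt vis qu := by
  obtain ⟨h1, h2, h3, h4⟩ := h
  refine ⟨h1, h2, h3, fun e he => ?_⟩
  have : e < i ∨ e = i := by omega
  grind

theorem search (h : Roots m ex mX m qt vis qu) :
    Search m ex ey mX mY 0 qt cur 0 0 vis qu (fun _ => 0) par := by
  obtain ⟨h1, h2, h3, h4⟩ := h
  have hr : ∀ x ∈ EnvyFree.active m ex, mX x = 0 → vis x ≠ 0 := by
    intro x hx
    obtain ⟨e, he, rfl⟩ := mem_active.1 hx
    exact h4 e he
  refine ⟨⟨h2, ?_, ?_, ?_, ?_⟩, h1, hr, ?_, ?_, ?_, ?_, ?_, ?_, ?_⟩ <;> grind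

end Roots

namespace Search

variable (h : Search m ex ey mX mY qh qt cur p found vis qu vy par)
include h

theorem pot_le (hp : p = 0) : searchPot m ex qh cur p vis ≤ 2 * m := by
  subst hp
  have h1 : searchPot m ex qh cur 0 vis ≤ ∑ x ∈ EnvyFree.active m ex, (rest ex m x + 1) := by
    rw [searchPot, rest_zero, add_zero]
    exact Finset.sum_le_sum fun x _ => by split_ifs <;> omega
  rw [Finset.sum_add_distrib, sum_rest, Finset.sum_const, smul_eq_mul, mul_one] at h1
  have := card_active_le (m := m) (ex := ex)
  omega

theorem pop (hL : Lists m ex hd nx) (hp : p = 0) (hq : qh < qt) :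
    Search m ex ey mX mY (qh + 1) qt (qu qh) (hd (qu qh)) found vis qu vy par ∧
    searchPot m ex (qh + 1) (qu qh) (hd (qu qh)) vis + 1 ≤ searchPot m ex qh cur p vis := by
  obtain ⟨⟨f1, f2, f3, f4, f5⟩, h1, h2, h3, h4, h5, h6, h7, h8, h9⟩ := h
  subst hp
  have hv : vis (qu qh) = qh + 1 := (h1 _ _).1 ⟨hq, rfl⟩
  have hx := f1 _ (by rw [hv]; omega)
  refine ⟨⟨⟨f1, f2, f3, f4, f5⟩, h1, h2, h3, h4, h5, ?_, hL.head_le _, ?_, hq⟩, ?_⟩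
  · intro e he hve hle hy
    have : vis (ex e) = qh + 1 := by
      by_contra hne
      have := h6 e he hve (by omega) hy
      omega
    have : ex e = qu qh := by
      have := ((h1 _ _).2 this).2
      exact this.symm
    exact ⟨this, this ▸ hL.head_max e he⟩
  · intro e he
    exact ⟨hL.head_pos _ _ he, hv, by omega⟩
  · have : rest ex (hd (qu qh)) (qu qh) ≤ rest ex m (qu qh) := rest_mono (hL.head_le _) _
    have hlt : ∑ x ∈ EnvyFree.active m ex,
          (if vis x ≠ 0 ∧ vis x ≤ qh + 1 then 0 else rest ex m x + 1) + (rest ex m (qu qh) + 1) ≤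
        ∑ x ∈ EnvyFree.active m ex, (if vis x ≠ 0 ∧ vis x ≤ qh then 0 else rest ex m x + 1) := by
      rw [← Finset.sum_erase_add _ _ hx, ← Finset.sum_erase_add (EnvyFree.active m ex) _ hx]
      have : ∑ x ∈ (EnvyFree.active m ex).erase (qu qh),
            (if vis x ≠ 0 ∧ vis x ≤ qh + 1 then 0 else rest ex m x + 1) ≤
          ∑ x ∈ (EnvyFree.active m ex).erase (qu qh),
            (if vis x ≠ 0 ∧ vis x ≤ qh then 0 else rest ex m x + 1) :=
        Finset.sum_le_sum fun x _ => by split_ifs <;> omega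
      rw [if_pos (by omega), if_neg (by omega)]
      omega
    simp only [searchPot, rest_zero]
    omega

theorem ptr_lt {e : ℕ} (hp : p = e + 1) : e < m := by
  have := h.ptr_le
  omega

theorem pot_next (hL : Lists m ex hd nx) {e : ℕ} (hp : p = e + 1) :
    searchPot m ex qh cur (nx e) vis + 1 ≤ searchPot m ex qh cur p vis := by
  have := hL.rest_next_lt (h.ptr_lt hp) (h.ptr_pos e hp).1
  simp only [searchPot, hp]
  omega

theorem scan_old (hL : Lists m ex hd nx) {e : ℕ} (hp : p = e + 1) (hy : vy (ey e) ≠ 0) :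
    Search m ex ey mX mY qh qt cur (nx e) found vis qu vy par := by
  have hem := h.ptr_lt hp
  obtain ⟨⟨f1, f2, f3, f4, f5⟩, h1, h2, h3, h4, h5, h6, h7, h8, h9⟩ := h
  have hn := hL.next_le e hem
  have h8e := h8 e hp
  refine ⟨⟨f1, f2, f3, f4, f5⟩, h1, h2, h3, h4, h5, ?_, ?_, ?_, h9⟩
  · intro e' he' hv hle hye
    have := hL.next_max e hem e'
    have := h6 e' he' hv hle hye
    grind
  · omega
  · intro q hq
    have := hL.next_pos e hem q hq
    grind

theorem scan_free (hM : Mates m ex ey mX mY) (hL : Lists m ex hd nx) {e : ℕ} (hp : p = e + 1)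
    (hm : mY (ey e) = 0) :
    Search m ex ey mX mY qh qt cur (nx e) (ey e + 1) vis qu (Function.update vy (ey e) 1)
      (Function.update par (ey e) cur) := by
  have hem := h.ptr_lt hp
  obtain ⟨⟨f1, f2, f3, f4, f5⟩, h1, h2, h3, h4, h5, h6, h7, h8, h9⟩ := h
  have hn := hL.next_le e hem
  have h8e := h8 e hp
  have hE : Edge m ex ey cur (ey e) := ⟨e, hem, h8e.1, rfl⟩
  have hiff := hM.iff
  refine ⟨⟨f1, ?_, ?_, ?_, ?_⟩, h1, h2, ?_, ?_, ?_, ?_, ?_, ?_, h9⟩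
  · intro x y; have := f2 x y; simp only [Function.update_apply]; split_ifs <;> grind
  · intro y; have := f3 y; simp only [Function.update_apply]; split_ifs <;> grind
  · intro y; have := f4 y; simp only [Function.update_apply]; split_ifs <;> grind
  · intro x y; have := f5 x y; have := hiff x y; simp only [Function.update_apply]
    split_ifs <;> grind
  · intro y; have := h3 y; simp only [Function.update_apply]; split_ifs <;> grind
  · intro y; have := h4 y; simp only [Function.update_apply]; split_ifs <;> grind
  · intro y; have := h5 y; simp only [Function.update_apply]; split_ifs <;> grind
  · intro e' he' hv hle
    have := hL.next_max e hem e'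
    have := h6 e' he' hv hle
    simp only [Function.update_apply]; split_ifs <;> grind
  · omega
  · intro q hq
    have := hL.next_pos e hem q hq
    grind

theorem scan_push (hM : Mates m ex ey mX mY) (hL : Lists m ex hd nx) {e w : ℕ} (hp : p = e + 1)
    (hy : vy (ey e) = 0) (hm : mY (ey e) = w + 1) :
    Search m ex ey mX mY qh (qt + 1) cur (nx e) found (Function.update vis w (qt + 1))
      (Function.update qu qt w) (Function.update vy (ey e) 1)
      (Function.update par (ey e) cur) ∧
    searchPot m ex qh cur (nx e) (Function.update vis w (qt + 1)) + 1 ≤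
      searchPot m ex qh cur p vis := by
  have hem := h.ptr_lt hp
  have hpot := h.pot_next hL hp
  obtain ⟨⟨f1, f2, f3, f4, f5⟩, h1, h2, h3, h4, h5, h6, h7, h8, h9⟩ := h
  have hn := hL.next_le e hem
  have h8e := h8 e hp
  have hE : Edge m ex ey cur (ey e) := ⟨e, hem, h8e.1, rfl⟩
  have hiff := hM.iff
  have hwy : mX w = ey e + 1 := (hiff _ _).2 hm
  have hw : vis w = 0 := by
    by_contra hne
    exact f2 w _ hne hwy hy
  have hwa : w ∈ EnvyFree.active m ex := (Finset.mem_filter.1 (hM.mem_matched hwy)).1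
  refine ⟨⟨⟨?_, ?_, ?_, ?_, ?_⟩, h1.push hw, ?_, ?_, ?_, ?_, ?_, ?_, ?_, by omega⟩, ?_⟩
  · intro x; have := f1 x; simp only [Function.update_apply]; split_ifs <;> grind
  · intro x y; have := f2 x y; simp only [Function.update_apply]; split_ifs <;> grind
  · intro y; have := f3 y; simp only [Function.update_apply]; split_ifs <;> grind
  · intro y; have := f4 y; simp only [Function.update_apply]; split_ifs <;> grind
  · intro x y; have := f5 x y; have := f3 y; have := hiff x y
    have hle := h1.vis_le (par y)
    simp only [Function.update_apply]
    split_ifs <;> grind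
  · intro x; have := h2 x; simp only [Function.update_apply]; split_ifs <;> grind
  · intro y; have := h3 y; simp only [Function.update_apply]; split_ifs <;> grind
  · intro y; have := h4 y; simp only [Function.update_apply]; split_ifs <;> grind
  · intro y; have := h5 y; simp only [Function.update_apply]; split_ifs <;> grind
  · intro e' he'
    have := hL.next_max e hem e'
    have := h6 e' he'
    simp only [Function.update_apply]; split_ifs <;> grind
  · omega
  · intro q hq
    have := hL.next_pos e hem q hq
    simp only [Function.update_apply]; split_ifs <;> grind
  · refine le_trans (Nat.succ_le_succ
      (Nat.add_le_add_right (Finset.sum_le_sum fun x _ => ?_) _)) hpot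
    by_cases hxw : x = w
    · subst hxw
      rw [Function.update_self, if_neg (by omega), if_neg (by omega)]
    · rw [Function.update_of_ne hxw]

theorem closed_of_not_found (hM : Mates m ex ey mX mY) (hp : p = 0) (hq : ¬ qh < qt)
    (hf : found = 0) : Closed m ex ey mX mY vis vy par := by
  obtain ⟨hF, h1, h2, h3, h4, h5, h6, h7, h8, h9⟩ := h
  refine ⟨hM, hF, h2, h3, fun y hy hm => h4 y hy hm hf, fun e he hv hy => ?_⟩
  have := h6 e he hv ((h1.vis_le _).trans (by omega)) hy
  omega

theorem flip (hM : Mates m ex ey mX mY) : found ≠ 0 →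
    Flip m ex ey mX vis vy par found mX mY := by
  intro hf
  obtain ⟨y, rfl⟩ := Nat.exists_eq_succ_of_ne_zero hf
  obtain ⟨hy, hm⟩ := h.found_eq y rfl
  refine ⟨?_, by simp, ?_, by simp, by simp, by simp⟩
  · intro z hz
    obtain rfl : y = z := by omega
    rwa [← hm, Function.update_eq_self]
  · intro z hz
    obtain rfl : y = z := by omega
    exact hy

theorem vis_le : ∀ x, vis x ≤ m := by
  intro x
  refine (h.queue.vis_le x).trans ?_
  -- the queue has no repetitions
  refine le_trans ?_ (card_active_le (m := m) (ex := ex))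
  rw [← Finset.card_range qt]
  have key : ∀ i < qt, vis (qu i) = i + 1 := fun i hi => (h.queue _ _).1 ⟨hi, rfl⟩
  refine Finset.card_le_card_of_injOn qu (fun i hi => ?_) fun i hi j hj hij => ?_
  · exact h.active _ (by rw [key i (by simpa using hi)]; omega)
  · have h1 := key i (by simpa using hi)
    have h2 := key j (by simpa using hj)
    rw [hij] at h1
    omega

end Search

theorem Flip.step {mX₀ : ℕ → ℕ} {y : ℕ} (hF : Forest m ex ey mX₀ vis vy par)
    (h : Flip m ex ey mX₀ vis vy par (y + 1) mX mY) :
    Flip m ex ey mX₀ vis vy par (mX (par y)) (Function.update mX (par y) (y + 1))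
      (Function.update mY y (par y + 1)) ∧
    ∀ y', mX (par y) = y' + 1 → vis (par y') < vis (par y) := by
  obtain ⟨h1, h2, h3, h4, -, -⟩ := h
  replace h1 := h1 y rfl
  replace h2 := h2 y rfl
  replace h3 := h3 y rfl
  replace h4 := fun x => h4 y x rfl
  have hE := hF.edge_par y h3
  have hx := hF.active _ (hF.vis_par y h3)
  have hx0 := h4 _ le_rfl
  have hlt : ∀ y', mX (par y) = y' + 1 → vis (par y') < vis (par y) := fun y' hy' =>
    hF.lt _ _ (hF.mate _ _ (hF.vis_par y h3) (hx0 ▸ hy')) (hx0 ▸ hy')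
  obtain ⟨i1, i2⟩ := h1
  refine ⟨⟨?_, ?_, ?_, ?_, ?_, ?_⟩, hlt⟩
  · intro y' hy'
    have i3 := (i1 (par y) y').1 hy'
    constructor
    · intro a b
      have := i1 a b
      have := i1 a y
      have := i1 (par y) b
      simp only [Function.update_apply] at *
      split_ifs <;> grind
    · intro a b
      have := i2 a b
      simp only [Function.update_apply]
      split_ifs <;> grind
  · intro y' hy'
    rw [← h2]
    ext z
    simp only [EnvyFree.matched, Finset.mem_filter, Function.update_apply]
    split_ifs <;> grind
  · intro y' hy'
    exact hF.mate _ _ (hF.vis_par y h3) (hx0 ▸ hy')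
  · intro y' z hy' hz
    have := hlt y' hy'
    have hne : z ≠ par y := by rintro rfl; omega
    rw [Function.update_of_ne hne]
    exact h4 z (by omega)
  · intro h0
    have := Mates.swap ⟨i1, i2⟩ h0 hE
    simpa using this
  · intro h0
    have hn : par y ∉ EnvyFree.matched m ex mX₀ := by
      rw [← h2]; simp [EnvyFree.matched, h0]
    rw [← Finset.card_insert_of_notMem hn, ← h2]
    congr 1
    ext z
    simp only [EnvyFree.matched, Finset.mem_filter, Finset.mem_insert, Function.update_apply]
    split_ifs <;> grind

/-! ### Depths in a forest -/

/-- The number of steps that lead from `x` to a root, where a step replaces `x` by `pr x` provided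
that this decreases `vis`. -/
def depth (vis pr : ℕ → ℕ) (x : ℕ) : ℕ :=
  if vis (pr x) < vis x then depth vis pr (pr x) + 1 else 0
termination_by vis x

theorem Forest.exists_depth (hF : Forest m ex ey mX vis vy par) :
    ∃ d : ℕ → ℕ, (∀ x, mX x = 0 → d x = 0) ∧
      ∀ x y, vy y ≠ 0 → mX x = y + 1 → d x = d (par y) + 1 := by
  refine ⟨depth vis fun x => if mX x = 0 then x else par (mX x - 1), fun x hx => ?_,
    fun x y hy hx => ?_⟩
  · rw [depth]; simp [hx]
  · rw [depth]; simp [hx, hF.lt x y hy hx]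

end Coded

/-! ### The program -/

section Prog

/-- The end in `X` of the current edge. -/
def endX : Expr := .cell 0 (.reg 4)

/-- The end in `Y` of the current edge. -/
def endY : Expr := .cell 1 (.reg 4)

/-- Puts into register `3` the least `K` with `K (K + 1) ≥ 2 n`, where `n` is the least of `|X|`,
`|Y|` and the number of edges, by counting up to `1 + 2 + ⋯ + K ≥ n`. -/
def boundProg : Program :=
  .assign 3 (.lit 0) ;; .assign 5 (.reg 2) ;;
  .cond (.lt (.reg 0) (.reg 5)) (.assign 5 (.reg 0)) .skip ;;
  .cond (.lt (.reg 1) (.reg 5)) (.assign 5 (.reg 1)) .skip ;;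
  .assign 6 (.lit 0) ;; .assign 7 (.lit 0) ;;
  .loop (.lt (.reg 6) (.reg 5))
    (.cond (.eq (.reg 7) (.lit 0)) (.assign 3 (.succ (.reg 3)) ;; .assign 7 (.reg 3)) .skip ;;
    .assign 7 (.pred (.reg 7)) ;; .assign 6 (.succ (.reg 6)))

/-- Builds the lists of the edges at the vertices of `X`: arrays `4` (heads) and `5`
(successors). -/
def listsProg : Program :=
  forEdges (.store 5 (.reg 4) (.cell 4 endX) ;; .store 4 endX (.succ (.reg 4)))

/-- The bidder in register `5`, stored as `x + 1`. -/
def bidder : Expr := .pred (.reg 5)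

/-- The vertex `x` in register `5`, stored as `x + 1`, makes one offer. Arrays `6` and `7` hold the
matching, `8` the levels, `9` the prices and `10` the pointers. -/
def bidProg : Program :=
  .cond (.eq (.cell 10 bidder) (.lit 0))
    (.cond (.lt (.cell 8 bidder) (.reg 3))
      (.store 8 bidder (.succ (.cell 8 bidder)) ;; .store 10 bidder (.cell 4 bidder))
      (.assign 5 (.lit 0)))
    (.assign 6 (.pred (.cell 10 bidder)) ;;
    .store 10 bidder (.cell 5 (.reg 6)) ;;
    .assign 7 (.cell 1 (.reg 6)) ;;
    .cond (.lt (.cell 9 (.reg 7)) (.cell 8 bidder))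
      (.store 9 (.reg 7) (.cell 8 bidder) ;;
      .store 6 bidder (.succ (.reg 7)) ;;
      .assign 8 (.cell 7 (.reg 7)) ;;
      .store 7 (.reg 7) (.reg 5) ;;
      .cond (.eq (.reg 8) (.lit 0)) .skip (.store 6 (.pred (.reg 8)) (.lit 0)) ;;
      .assign 5 (.reg 8))
      .skip)

/-- The auction. -/
def auctionProg : Program :=
  forEdges (.cond (.eq (.cell 6 endX) (.lit 0))
    (.assign 5 (.succ endX) ;; .loop (.neg (.eq (.reg 5) (.lit 0))) bidProg) .skip)

/-- Forgets the vertices that were reached: arrays `11` (for `X`) and `3` (for `Y`). -/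
def resetProg : Program :=
  forEdges (.store 11 endX (.lit 0) ;; .store 3 endY (.lit 0))

/-- Puts a vertex of `X` into the queue in array `12`. -/
def pushProg (v : Expr) : Program :=
  .store 12 (.reg 10) v ;; .assign 10 (.succ (.reg 10)) ;; .store 11 v (.reg 10)

/-- Puts the unmatched vertices of `X` into the queue. -/
def rootsProg : Program :=
  .assign 9 (.lit 0) ;; .assign 10 (.lit 0) ;; .assign 11 (.lit 0) ;; .assign 6 (.lit 0) ;;
  forEdges (.cond (.conj (.eq (.cell 6 endX) (.lit 0)) (.eq (.cell 11 endX) (.lit 0)))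
    (pushProg endX) .skip)

/-- The search from the vertices in the queue. Array `13` holds the parents; a vertex `y` that is
reached and unmatched is left as `y + 1` in register `11`. -/
def searchProg : Program :=
  .loop (.neg (.conj (.eq (.reg 6) (.lit 0)) (.neg (.lt (.reg 9) (.reg 10)))))
    (.cond (.eq (.reg 6) (.lit 0))
      (.assign 5 (.cell 12 (.reg 9)) ;; .assign 9 (.succ (.reg 9)) ;; .assign 6 (.cell 4 (.reg 5)))
      (.assign 7 (.cell 1 (.pred (.reg 6))) ;; .assign 6 (.cell 5 (.pred (.reg 6))) ;;
      .cond (.eq (.cell 3 (.reg 7)) (.lit 0))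
        (.store 3 (.reg 7) (.lit 1) ;; .store 13 (.reg 7) (.reg 5) ;;
        .assign 8 (.cell 7 (.reg 7)) ;;
        .cond (.eq (.reg 8) (.lit 0)) (.assign 11 (.succ (.reg 7))) (pushProg (.pred (.reg 8))))
        .skip))

/-- Flips the augmenting path that leads to the vertex in register `11`. -/
def flipProg : Program :=
  .loop (.neg (.eq (.reg 11) (.lit 0)))
    (.assign 5 (.cell 13 (.pred (.reg 11))) ;; .assign 7 (.cell 6 (.reg 5)) ;;
    .store 6 (.reg 5) (.reg 11) ;; .store 7 (.pred (.reg 11)) (.succ (.reg 5)) ;;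
    .assign 11 (.reg 7))

/-- One search, which either enlarges the matching or sets register `12`. -/
def roundProg : Program :=
  resetProg ;; rootsProg ;; searchProg ;;
  .cond (.eq (.reg 11) (.lit 0)) (.assign 12 (.lit 1)) flipProg

/-- Marks in array `2` the vertices of `X` that were not reached. -/
def outputProg : Program :=
  forEdges (.cond (.eq (.cell 11 endX) (.lit 0)) (.store 2 endX (.lit 1)) .skip)

/-- The program that computes the partitions. -/
def partitionProg : Program :=
  boundProg ;; listsProg ;; auctionProg ;;
  .assign 12 (.lit 0) ;; .loop (.eq (.reg 12) (.lit 0)) roundProg ;; outputProg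

end Prog

/-! ### Correctness and running time of the program -/

section Correct

attribute [local simp] endX endY bidder

/-- The value of register `3` is `⌈√(2 n)⌉` up to one, as the two bounds on its square say. Register
`7` is what the last summand `K` still has to contribute, so that the sum of registers `6` and `7`
is always `1 + 2 + ⋯ + K`. -/
theorem wp_boundProg (s : State) :
    WP boundProg s fun t s' => t ≤ 30 * s.reg 2 + 40 ∧ s'.arr = s.arr ∧ s'.reg 2 = s.reg 2 ∧
      2 * min (s.reg 2) (min (s.reg 0) (s.reg 1)) ≤ s'.reg 3 * (s'.reg 3 + 1) ∧
      (s'.reg 3 ≠ 0 → s'.reg 3 * s'.reg 3 ≤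
        2 * min (s.reg 2) (min (s.reg 0) (s.reg 1)) + s'.reg 3) := by
  set n := min (s.reg 2) (min (s.reg 0) (s.reg 1)) with hn
  have hloop : ∀ s₁ : State, s₁.arr = s.arr → s₁.reg 2 = s.reg 2 → s₁.reg 5 = n →
      s₁.reg 6 = 0 → s₁.reg 7 = 0 → s₁.reg 3 = 0 → WP (.loop (.lt (.reg 6) (.reg 5))
    (.cond (.eq (.reg 7) (.lit 0)) (.assign 3 (.succ (.reg 3)) ;; .assign 7 (.reg 3)) .skip ;;
    .assign 7 (.pred (.reg 7)) ;; .assign 6 (.succ (.reg 6)))) s₁ fun t s' => t ≤ 30 * n + 10 ∧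
      s'.arr = s.arr ∧ s'.reg 2 = s.reg 2 ∧ 2 * n ≤ s'.reg 3 * (s'.reg 3 + 1) ∧
      (s'.reg 3 ≠ 0 → s'.reg 3 * s'.reg 3 ≤ 2 * n + s'.reg 3) := by
    intro s₁ h1 h2 h3 h4 h5 h6
    refine (wp_loop (fun s' => s'.arr = s.arr ∧ s'.reg 2 = s.reg 2 ∧ s'.reg 5 = n ∧
      s'.reg 6 ≤ n ∧ 2 * (s'.reg 6 + s'.reg 7) = s'.reg 3 * (s'.reg 3 + 1) ∧
      (s'.reg 7 < s'.reg 3 ∨ s'.reg 3 = 0)) (fun s' => (n - s'.reg 6) * 30) ?_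
        (s := s₁) ?_).mono ?_
    · rintro s' ⟨g1, g2, g3, g4, g5, g6⟩ hb
      simp only [Test.Holds, Expr.val, g3] at hb
      refine wp_seq (wp_cond (fun h => wp_seq (wp_assign (wp_assign ?_))) (fun h => wp_skip ?_)) <;>
      refine wp_seq (wp_assign (wp_assign ?_)) <;>
      simp only [Test.Holds, Expr.val] at h
      · simp [g1, g2, g3]
        refine ⟨⟨hb, ?_⟩, by omega⟩
        rw [h] at g5
        nlinarith
      · simp [g1, g2, g3]
        refine ⟨⟨hb, ?_, by omega⟩, by omega⟩
        rw [← g5]; omega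
    · simp [h1, h2, h3, h4, h5, h6]
    · rintro t s' ⟨⟨g1, g2, g3, g4, g5, g6⟩, hb, ht⟩
      simp only [Test.Holds, Expr.val, g3] at hb
      have h6n : s'.reg 6 = n := by omega
      simp [h6n, h4] at ht g5
      refine ⟨by omega, g1, g2, by omega, fun h0 => ?_⟩
      nlinarith [show s'.reg 7 < s'.reg 3 by omega]
  unfold boundProg
  refine wp_seq (wp_assign (wp_seq (wp_assign (wp_seq (wp_cond (fun h => wp_assign ?_)
      (fun h => wp_skip ?_)))))) <;>
  refine wp_seq (wp_cond (fun h' => wp_assign ?_) (fun h' => wp_skip ?_)) <;>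
  refine wp_seq (wp_assign (wp_seq (wp_assign ((hloop _ ?_ ?_ ?_ ?_ ?_ ?_).mono ?_)))) <;>
  simp at h h' ⊢ <;> first | omega | skip
  all_goals
    intro t s' h1 h2 h3 h4 h5
    exact ⟨by omega, h2, h3, h4, h5⟩

theorem wp_listsProg {m : ℕ} {ex : ℕ → ℕ} (s : State) (hm : s.reg 2 = m) (hex : s.arr 0 = ex)
    (h4 : s.arr 4 = fun _ => 0) :
    WP listsProg s fun t s' => t ≤ 30 * m + 10 ∧ Lists m ex (s'.arr 4) (s'.arr 5) ∧
      s'.reg 2 = m ∧ s'.reg 3 = s.reg 3 ∧ ∀ a, a ≠ 4 → a ≠ 5 → s'.arr a = s.arr a := by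
  refine (wp_forEdges (m := m) (fun i s' => Lists i ex (s'.arr 4) (s'.arr 5) ∧ s'.reg 3 = s.reg 3 ∧
    ∀ a, a ≠ 4 → a ≠ 5 → s'.arr a = s.arr a) (fun _ => 0) 20 hm ?_ le_rfl ?_).mono ?_
  · refine ⟨?_, by simp, by simp⟩
    simp only [State.arr_setReg, h4]
    constructor <;> simp
  · rintro i hi s' g2 g4 ⟨⟨l1, l2, l3, l4, l5, l6⟩, g3, ga⟩
    refine wp_seq (wp_store (wp_store ?_))
    have h0 : s'.arr 0 = ex := by rw [ga 0 (by simp) (by simp), hex]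
    simp [g2, g4, g3, h0]
    refine ⟨⟨?_, ?_, ?_, ?_, ?_, ?_⟩, fun a ha hb => by simp [ha, hb, ga]⟩
    · intro x; have := l1 x; simp only [Function.update_apply]; split_ifs <;> grind
    · intro x; have := l2 x; simp only [Function.update_apply]; split_ifs <;> grind
    · intro e he; have := l3 e; simp only [Function.update_apply]; split_ifs <;> grind
    · intro e he; have := l4 e; have := l1 (ex i)
      simp only [Function.update_apply]; split_ifs <;> grind
    · intro e he; have := l5 e; have := l2 (ex i)
      simp only [Function.update_apply]; split_ifs <;> grind
    · intro e he; have := l6 e; have := l3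
      simp only [Function.update_apply]; split_ifs <;> grind
  · rintro t s' ⟨⟨h1, h2, h3⟩, h5, h6⟩
    exact ⟨by omega, h1, h5, h2, h3⟩

/-- The data that the program does not change after the lists of edges have been built. -/
structure Setup (m K : ℕ) (ex ey hd nx : ℕ → ℕ) (s : State) : Prop where
  reg2 : s.reg 2 = m
  reg3 : s.reg 3 = K
  arr0 : s.arr 0 = ex
  arr1 : s.arr 1 = ey
  arr4 : s.arr 4 = hd
  arr5 : s.arr 5 = nx

variable {m K : ℕ} {ex ey hd nx : ℕ → ℕ}

theorem Setup.setReg {m K : ℕ} {ex ey hd nx : ℕ → ℕ} {s : State} (h : Setup m K ex ey hd nx s)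
    {r v : ℕ} (h2 : r ≠ 2) (h3 : r ≠ 3) : Setup m K ex ey hd nx (s.setReg r v) := by
  obtain ⟨k2, k3, k0, k1, ka, kb⟩ := h
  constructor <;> simp [*, h2.symm, h3.symm]

/-- The part of the memory that the auction does not use. -/
def Untouched (s s' : State) : Prop :=
  s'.arr 2 = s.arr 2 ∧ s'.arr 3 = s.arr 3 ∧ s'.arr 11 = s.arr 11

theorem wp_bidProg (hL : Lists m ex hd nx) {i j x : ℕ} (s : State) (hs : Setup m K ex ey hd nx s)
    (h5 : s.reg 5 = x + 1) (h4 : s.reg 4 = i)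
    (hA : Auction m ex ey K j (x + 1) (s.arr 6) (s.arr 7) (s.arr 8) (s.arr 9) (s.arr 10)) :
    WP bidProg s fun t s' => Setup m K ex ey hd nx s' ∧ s'.reg 4 = i ∧ Untouched s s' ∧
      Auction m ex ey K j (s'.reg 5) (s'.arr 6) (s'.arr 7) (s'.arr 8) (s'.arr 9) (s'.arr 10) ∧
      t ≤ 80 ∧ (s'.reg 5 = 0 ∧ s'.arr 8 = s.arr 8 ∧ s'.arr 10 = s.arr 10 ∨
        auctionPot m ex K (s'.arr 8) (s'.arr 10) + 1 ≤
        auctionPot m ex K (s.arr 8) (s.arr 10)) := by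
  obtain ⟨k2, k3, k0, k1, ka, kb⟩ := hs
  refine wp_cond (fun h => wp_cond (fun h' => wp_seq (wp_store (wp_store ?_)))
    (fun h' => wp_assign ?_)) (fun h => wp_seq (wp_assign (wp_seq (wp_store (wp_seq (wp_assign
      (wp_cond (fun h' => wp_seq (wp_store (wp_seq (wp_store (wp_seq (wp_assign (wp_seq (wp_store
        (wp_seq (wp_cond (fun h'' => wp_skip (wp_assign ?_)) (fun h'' => wp_store
          (wp_assign ?_))))))))))))
      (fun h' => wp_skip ?_)))))))) <;>
  simp [h5, k3, k1, ka, kb] at h h' ⊢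
  · obtain ⟨g1, g2⟩ := hA.raise hL h h'
    exact ⟨by constructor <;> simp [*], h4, by simp [Untouched], g1, g2⟩
  · exact ⟨by constructor <;> simp [*], h4, by simp [Untouched], hA.drop h (by omega)⟩
  · obtain ⟨p, hp⟩ := Nat.exists_eq_succ_of_ne_zero h
    simp [hp, h5, k1] at h' h'' ⊢
    obtain ⟨g1, g2⟩ := hA.take hL hp h'
    rw [if_pos h''] at g1
    exact ⟨by constructor <;> simp [*], h4, by simp [Untouched], g1, .inr g2⟩
  · obtain ⟨p, hp⟩ := Nat.exists_eq_succ_of_ne_zero h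
    simp [hp, h5, k1] at h' h'' ⊢
    obtain ⟨g1, g2⟩ := hA.take hL hp h'
    rw [if_neg h''] at g1
    exact ⟨by constructor <;> simp [*], h4, by simp [Untouched], g1, .inr g2⟩
  · obtain ⟨p, hp⟩ := Nat.exists_eq_succ_of_ne_zero h
    simp [hp] at h' ⊢
    obtain ⟨g1, g2⟩ := hA.pass hL hp (by omega)
    exact ⟨by constructor <;> simp [*], h4, by simp [Untouched], g1, g2⟩

theorem wp_auctionProg (hL : Lists m ex hd nx) (s : State) (hs : Setup m K ex ey hd nx s)
    (h0 : ∀ a, a = 6 ∨ a = 7 ∨ a = 8 ∨ a = 9 ∨ a = 10 → s.arr a = fun _ => 0) :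
    WP auctionProg s fun t s' => Setup m K ex ey hd nx s' ∧ Untouched s s' ∧
      Auction m ex ey K m 0 (s'.arr 6) (s'.arr 7) (s'.arr 8) (s'.arr 9) (s'.arr 10) ∧
      t ≤ 200 * (m * K) + 200 * m + 10 := by
  refine (wp_forEdges (m := m) (fun i s' => Setup m K ex ey hd nx s' ∧ Untouched s s' ∧
    Auction m ex ey K i 0 (s'.arr 6) (s'.arr 7) (s'.arr 8) (s'.arr 9) (s'.arr 10))
    (fun s' => 100 * auctionPot m ex K (s'.arr 8) (s'.arr 10)) 150 hs.reg2 ?_ ?_ ?_).mono ?_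
  · refine ⟨hs.setReg (by simp) (by simp), by simp [Untouched], ?_⟩
    simpa [h0] using Auction.init
  · simp
  · rintro i hi s' g2 g4 ⟨gs, gu, gA⟩
    have k0 := gs.arr0
    refine wp_cond (fun h => wp_seq (wp_assign ?_)) (fun h => wp_skip ?_) <;>
      simp [g4, k0] at h ⊢
    · refine (wp_loop (fun s'' => Setup m K ex ey hd nx s'' ∧ s''.reg 4 = i ∧ Untouched s s'' ∧
        Auction m ex ey K (i + 1) (s''.reg 5) (s''.arr 6) (s''.arr 7) (s''.arr 8) (s''.arr 9)
          (s''.arr 10)) (fun s'' => 100 * auctionPot m ex K (s''.arr 8) (s''.arr 10) +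
          if s''.reg 5 = 0 then 0 else 100) ?_
        (s := s'.setReg 5 (ex i + 1)) ?_).mono ?_
      · rintro s₁ ⟨e1, e2, e3, e4⟩ hb
        simp at hb
        obtain ⟨x, hx⟩ := Nat.exists_eq_succ_of_ne_zero hb
        refine (wp_bidProg hL s₁ e1 hx e2 (hx ▸ e4)).mono ?_
        rintro t s₂ ⟨f1, f2, f3, f4, ft, fp⟩
        refine ⟨⟨f1, f2, ?_, f4⟩, ?_⟩
        · simp only [Untouched] at e3 f3 ⊢
          simp only [f3, e3, and_self]
        · simp only [hx, Test.cost, Expr.cost, Nat.add_one_ne_zero, if_false]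
          rcases fp with ⟨p1, p2, p3⟩ | fp
          · simp only [p1, p2, p3, if_true]
            omega
          · split_ifs <;> omega
      · refine ⟨gs.setReg (by simp) (by simp), by simp [g4], by simpa [Untouched] using gu, ?_⟩
        simpa using gA.start hi h
      · rintro t s₁ ⟨⟨e1, e2, e3, e4⟩, hb, ht⟩
        simp at hb ht
        rw [hb] at e4
        exact ⟨e1.reg2, e2, ⟨e1.setReg (by simp) (by simp), by simpa [Untouched] using e3, e4⟩,
          by omega⟩
    · exact ⟨g2, ⟨gs.setReg (by simp) (by simp), by simpa [Untouched] using gu, gA.skip h⟩,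
        by omega⟩
  · rintro t s' ⟨⟨e1, e2, e3⟩, h2, ht⟩
    refine ⟨e1, e2, e3, ?_⟩
    have := auctionPot_zero (m := m) (ex := ex) (K := K)
    rw [h0 8 (by simp), h0 10 (by simp)] at ht
    nlinarith

end Correct

/-! ### The searches and the whole program -/

section Search

attribute [local simp] endX endY bidder

variable {m K : ℕ} {ex ey hd nx : ℕ → ℕ}

theorem Setup.setCell {s : State} (h : Setup m K ex ey hd nx s) {a i v : ℕ} (ha : 5 < a ∨ a = 3) :
    Setup m K ex ey hd nx (s.setCell a i v) := by
  obtain ⟨k2, k3, k0, k1, ka, kb⟩ := h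
  constructor <;> simp [*] <;> omega

/-- What the search does not change: the matching, the output array `2` and register `12`. -/
def Kept (s s' : State) : Prop :=
  s'.arr 2 = s.arr 2 ∧ s'.arr 6 = s.arr 6 ∧ s'.arr 7 = s.arr 7 ∧ s'.reg 12 = s.reg 12

theorem wp_resetProg (s : State) (hs : Setup m K ex ey hd nx s)
    (hX : ∀ x, s.arr 11 x ≠ 0 → ∃ e < m, ex e = x) (hY : ∀ y, s.arr 3 y ≠ 0 → ∃ e < m, ey e = y) :
    WP resetProg s fun t s' => Setup m K ex ey hd nx s' ∧ Kept s s' ∧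
      s'.arr 11 = (fun _ => 0) ∧ s'.arr 3 = (fun _ => 0) ∧ t ≤ 30 * m + 10 := by
  refine (wp_forEdges (m := m) (fun i s' => Setup m K ex ey hd nx s' ∧ Kept s s' ∧
    (∀ x, s'.arr 11 x ≠ 0 → ∃ e < m, i ≤ e ∧ ex e = x) ∧
    (∀ y, s'.arr 3 y ≠ 0 → ∃ e < m, i ≤ e ∧ ey e = y)) (fun _ => 0) 20 hs.reg2 ?_ le_rfl ?_).mono ?_
  · exact ⟨hs.setReg (by simp) (by simp), by simp [Kept], by simpa using hX, by simpa using hY⟩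
  · rintro i hi s' g2 g4 ⟨gs, gk, gX, gY⟩
    have k0 := gs.arr0
    have k1 := gs.arr1
    refine wp_seq (wp_store (wp_store ?_))
    refine ⟨by simp [g2], by simp [g4], ⟨((gs.setCell (by simp)).setCell (by simp)).setReg
      (by simp) (by simp), by simpa [Kept] using gk, ?_, ?_⟩, by simp⟩
    · intro x
      have := gX x
      simp [g4, k0, Function.update_apply]
      grind
    · intro y
      have := gY y
      simp [g4, k1, Function.update_apply]
      grind
  · rintro t s' ⟨⟨gs, gk, gX, gY⟩, h2, ht⟩
    refine ⟨gs, gk, ?_, ?_, by omega⟩ <;> funext z <;> by_contra hz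
    · obtain ⟨e, h1, h2, -⟩ := gX z hz
      omega
    · obtain ⟨e, h1, h2, -⟩ := gY z hz
      omega

theorem wp_rootsProg (s : State) (hs : Setup m K ex ey hd nx s) (hv : s.arr 11 = fun _ => 0) :
    WP rootsProg s fun t s' => Setup m K ex ey hd nx s' ∧ Kept s s' ∧ s'.arr 3 = s.arr 3 ∧
      Roots m ex (s.arr 6) m (s'.reg 10) (s'.arr 11) (s'.arr 12) ∧
      s'.reg 9 = 0 ∧ s'.reg 11 = 0 ∧ s'.reg 6 = 0 ∧ t ≤ 50 * m + 30 := by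
  refine wp_seq (wp_assign (wp_seq (wp_assign (wp_seq (wp_assign (wp_seq (wp_assign ?_)))))))
  refine (wp_forEdges (m := m) (fun i s' => Setup m K ex ey hd nx s' ∧ Kept s s' ∧
    s'.arr 3 = s.arr 3 ∧ Roots m ex (s.arr 6) i (s'.reg 10) (s'.arr 11) (s'.arr 12) ∧
    s'.reg 9 = 0 ∧ s'.reg 11 = 0 ∧ s'.reg 6 = 0) (fun _ => 0) 40 ?_ ?_ le_rfl ?_).mono ?_
  · simp [hs.reg2]
  · refine ⟨?_, by simp [Kept], by simp, ?_, by simp, by simp, by simp⟩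
    · refine Setup.setReg (Setup.setReg (Setup.setReg (Setup.setReg (Setup.setReg hs ?_ ?_) ?_ ?_)
        ?_ ?_) ?_ ?_) ?_ ?_ <;> simp
    · simpa [hv] using Roots.init
  · rintro i hi s' g2 g4 ⟨gs, gk, g3, gR, g9, g11, g6⟩
    have k0 := gs.arr0
    have k6 := gk.2.1
    refine wp_cond (fun h => wp_seq (wp_store (wp_seq (wp_assign (wp_store ?_)))))
      (fun h => wp_skip ?_) <;> simp [g4, k0, k6] at h ⊢
    · refine ⟨g2, ⟨Setup.setReg (Setup.setCell (Setup.setReg (Setup.setCell gs ?_) ?_ ?_) ?_) ?_ ?_,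
        by simpa [Kept] using gk, g3, gR.push hi h.1 h.2, g9, g11, g6⟩⟩ <;> simp
    · exact ⟨g2, ⟨gs.setReg (by simp) (by simp), by simpa [Kept] using gk, g3,
        gR.skip (by simpa using h), g9, g11, g6⟩⟩
  · rintro t s' ⟨⟨h1, h2, h3, h4, h5, h6, h7⟩, -, ht⟩
    exact ⟨h1, by simpa [Kept] using h2, h3, h4, h5, h6, h7, by simp; omega⟩

theorem wp_searchProg (hL : Lists m ex hd nx) (s : State) (hs : Setup m K ex ey hd nx s)
    (hM : Mates m ex ey (s.arr 6) (s.arr 7)) (h6 : s.reg 6 = 0)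
    (hS : Search m ex ey (s.arr 6) (s.arr 7) (s.reg 9) (s.reg 10) (s.reg 5) (s.reg 6) (s.reg 11)
      (s.arr 11) (s.arr 12) (s.arr 3) (s.arr 13)) :
    WP searchProg s fun t s' => Setup m K ex ey hd nx s' ∧ Kept s s' ∧
      Search m ex ey (s.arr 6) (s.arr 7) (s'.reg 9) (s'.reg 10) (s'.reg 5) 0 (s'.reg 11)
        (s'.arr 11) (s'.arr 12) (s'.arr 3) (s'.arr 13) ∧ ¬ s'.reg 9 < s'.reg 10 ∧
      t ≤ 200 * m + 20 := by
  refine (wp_loop (fun s' => Setup m K ex ey hd nx s' ∧ Kept s s' ∧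
      Search m ex ey (s.arr 6) (s.arr 7) (s'.reg 9) (s'.reg 10) (s'.reg 5) (s'.reg 6) (s'.reg 11)
        (s'.arr 11) (s'.arr 12) (s'.arr 3) (s'.arr 13))
      (fun s' => 100 * searchPot m ex (s'.reg 9) (s'.reg 5) (s'.reg 6) (s'.arr 11))
      ?_ (s := s) ?_).mono ?_
  · rintro s' ⟨gs, gk, gS⟩ hb
    have k1 := gs.arr1
    have k4 := gs.arr4
    have k5 := gs.arr5
    have k7 := gk.2.2.1
    refine wp_cond (fun h => wp_seq (wp_assign (wp_seq (wp_assign (wp_assign ?_)))))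
      (fun h => wp_seq (wp_assign (wp_seq (wp_assign (wp_cond (fun h' => wp_seq (wp_store (wp_seq
      (wp_store (wp_seq (wp_assign (wp_cond (fun h'' => wp_assign ?_) (fun h'' => wp_seq (wp_store
      (wp_seq (wp_assign (wp_store ?_))))))))))))
      (fun h' => wp_skip ?_)))))) <;>
    simp [k1, k4, k5, k7] at hb h ⊢
    · obtain ⟨g1, g2⟩ := gS.pop hL h (hb h)
      refine ⟨⟨Setup.setReg (Setup.setReg (Setup.setReg gs ?_ ?_) ?_ ?_) ?_ ?_,
        by simpa [Kept] using gk, g1⟩, by omega⟩ <;> simp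
    all_goals
      obtain ⟨e, he⟩ := Nat.exists_eq_succ_of_ne_zero h
      simp [k1, k5, he] at h' ⊢
    · simp [k1, k5, k7, he] at h''
      have g1 := gS.scan_free hM hL he h''
      have g2 := gS.pot_next hL he
      rw [he, Nat.succ_eq_add_one] at g2
      refine ⟨⟨?_, by simpa [Kept] using gk, g1⟩, by omega⟩
      refine Setup.setReg (Setup.setReg (Setup.setCell (Setup.setCell (Setup.setReg (Setup.setReg
        gs ?_ ?_) ?_ ?_) ?_) ?_) ?_ ?_) ?_ ?_ <;> simp
    · simp [k1, k5, k7, he] at h''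
      obtain ⟨w, hw⟩ := Nat.exists_eq_succ_of_ne_zero h''
      obtain ⟨g1, g2⟩ := gS.scan_push hM hL he h' hw
      rw [he, Nat.succ_eq_add_one] at g2
      simp [hw]
      refine ⟨⟨?_, by simpa [Kept] using gk, g1⟩, by omega⟩
      refine Setup.setCell (Setup.setReg (Setup.setCell (Setup.setReg (Setup.setCell (Setup.setCell
        (Setup.setReg (Setup.setReg gs ?_ ?_) ?_ ?_) ?_) ?_) ?_ ?_) ?_) ?_ ?_) ?_ <;> simp
    · have g1 := gS.scan_old hL he h'
      have g2 := gS.pot_next hL he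
      rw [he, Nat.succ_eq_add_one] at g2
      refine ⟨⟨?_, by simpa [Kept] using gk, g1⟩, by omega⟩
      refine Setup.setReg (Setup.setReg gs ?_ ?_) ?_ ?_ <;> simp
  · exact ⟨hs, by simp [Kept], hS⟩
  · rintro t s' ⟨⟨h1, h2, h3⟩, hb, ht⟩
    simp at hb ht
    have := hS.pot_le h6
    rw [hb.1] at h3
    exact ⟨h1, h2, h3, by omega, by omega⟩

theorem wp_flipProg {mX₀ vis vy par : ℕ → ℕ} (hF : Forest m ex ey mX₀ vis vy par)
    (hv : ∀ x, vis x ≤ m) (s : State) (hs : Setup m K ex ey hd nx s) (hp : s.arr 13 = par)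
    (h : Flip m ex ey mX₀ vis vy par (s.reg 11) (s.arr 6) (s.arr 7)) :
    WP flipProg s fun t s' => Setup m K ex ey hd nx s' ∧ s'.arr 2 = s.arr 2 ∧
      s'.arr 3 = s.arr 3 ∧ s'.arr 11 = s.arr 11 ∧ s'.reg 12 = s.reg 12 ∧
      Flip m ex ey mX₀ vis vy par 0 (s'.arr 6) (s'.arr 7) ∧ t ≤ 60 * m + 60 := by
  refine (wp_loop (fun s' => Setup m K ex ey hd nx s' ∧ s'.arr 13 = par ∧ (s'.arr 2 = s.arr 2 ∧
      s'.arr 3 = s.arr 3 ∧ s'.arr 11 = s.arr 11 ∧ s'.reg 12 = s.reg 12) ∧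
      Flip m ex ey mX₀ vis vy par (s'.reg 11) (s'.arr 6) (s'.arr 7))
      (fun s' => if s'.reg 11 = 0 then 0 else 40 * (vis (par (s'.reg 11 - 1)) + 1))
      ?_ (s := s) ?_).mono ?_
  · rintro s' ⟨gs, gp, gk, gF⟩ hb
    simp at hb
    obtain ⟨y, hy⟩ := Nat.exists_eq_succ_of_ne_zero hb
    refine wp_seq (wp_assign (wp_seq (wp_assign (wp_seq (wp_store (wp_seq (wp_store
      (wp_assign ?_))))))))
    rw [hy] at gF
    obtain ⟨g1, g2⟩ := gF.step hF
    simp [hy, gp]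
    refine ⟨⟨?_, gk, g1⟩, ?_⟩
    · refine Setup.setReg (Setup.setCell (Setup.setCell (Setup.setReg (Setup.setReg
        gs ?_ ?_) ?_ ?_) ?_) ?_) ?_ ?_ <;> simp
    · split_ifs with h0
      · omega
      · have := g2 (s'.arr 6 (par y) - 1) (by omega)
        omega
  · exact ⟨hs, hp, by simp, h⟩
  · rintro t s' ⟨⟨h1, h2, ⟨h3, h4, h5, h6⟩, h7⟩, hb, ht⟩
    simp at hb
    rw [hb] at h7
    simp only [hb, if_true, Test.cost, Expr.cost] at ht
    have := hv (par (s.reg 11 - 1))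
    refine ⟨h1, h3, h4, h5, h6, h7, ?_⟩
    split_ifs at ht <;> omega

/-- The invariant of the loop over the searches. -/
structure Main (m K : ℕ) (ex ey hd nx : ℕ → ℕ) (s : State) : Prop where
  setup : Setup m K ex ey hd nx s
  out : s.arr 2 = fun _ => 0
  mates : Mates m ex ey (s.arr 6) (s.arr 7)
  vis : ∀ x, s.arr 11 x ≠ 0 → ∃ e < m, ex e = x
  vy : ∀ y, s.arr 3 y ≠ 0 → ∃ e < m, ey e = y
  ended : s.reg 12 ≠ 0 → ∃ par, Closed m ex ey (s.arr 6) (s.arr 7) (s.arr 11) (s.arr 3) par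

theorem wp_roundProg (hL : Lists m ex hd nx) (s : State) (hs : Main m K ex ey hd nx s)
    (h12 : s.reg 12 = 0) :
    WP roundProg s fun t s' => Main m K ex ey hd nx s' ∧ t ≤ 400 * m + 200 ∧
      (s'.reg 12 ≠ 0 ∨
        (matched m ex (s'.arr 6)).card = (matched m ex (s.arr 6)).card + 1) := by
  obtain ⟨hs, ho, hM, hX, hY, -⟩ := hs
  refine wp_seq ((wp_resetProg s hs hX hY).mono ?_)
  rintro t₁ s₁ ⟨a1, ⟨a2, a3, a4, a5⟩, a6, a7, a8⟩
  refine wp_seq ((wp_rootsProg s₁ a1 a6).mono ?_)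
  rintro t₂ s₂ ⟨b1, ⟨b2, b3, b4, b5⟩, b6, b7, b8, b9, b10, b11⟩
  rw [a3] at b7 b3
  rw [a4] at b4
  have hS := b7.search (ey := ey) (mY := s.arr 7) (cur := s₂.reg 5) (par := s₂.arr 13)
  refine wp_seq ((wp_searchProg hL s₂ b1 (by rwa [b3, b4]) b10
    (by rw [b3, b4, b6, a7, b8, b9, b10]; exact hS)).mono ?_)
  rintro t₃ s₃ ⟨c1, ⟨c2, c3, c4, c5⟩, c6, c7, c8⟩
  rw [b3, b4] at c6
  rw [b3] at c3
  rw [b4] at c4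
  have hX' : ∀ x, s₃.arr 11 x ≠ 0 → ∃ e < m, ex e = x := fun x hx =>
    mem_active.1 (c6.active x hx)
  have hY' : ∀ y, s₃.arr 3 y ≠ 0 → ∃ e < m, ey e = y := fun y hy => by
    obtain ⟨e, he, -, hey⟩ := c6.edge_par y hy
    exact ⟨e, he, hey⟩
  refine wp_cond (fun h => wp_assign ?_) (fun h => ?_)
  · simp at h
    refine ⟨⟨c1.setReg (by simp) (by simp), by simp [c2, b2, a2, ho], by simpa [c3, c4] using hM,
      hX', hY', fun _ => ⟨s₃.arr 13, ?_⟩⟩, by simp; omega, by simp⟩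
    simpa [c3, c4] using c6.closed_of_not_found hM rfl c7 h
  · simp at h
    refine (wp_flipProg c6.toForest c6.vis_le s₃ c1 rfl
      (by rw [c3, c4]; exact c6.flip hM h)).mono ?_
    rintro t₄ s₄ ⟨d1, d2, d3, d4, d5, d6, d7⟩
    refine ⟨⟨d1, by rw [d2, c2, b2, a2, ho], d6.mates_end rfl, by rwa [d4], by rwa [d3], ?_⟩,
      by simp; omega, .inr (d6.card_end rfl)⟩
    intro hne
    rw [d5, c5, b5, a5, h12] at hne
    exact absurd rfl hne

theorem wp_outputProg (s : State) (hs : Setup m K ex ey hd nx s) (ho : s.arr 2 = fun _ => 0) :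
    WP outputProg s fun t s' => t ≤ 30 * m + 10 ∧ s'.arr 3 = s.arr 3 ∧
      ∀ x, s'.arr 2 x = if (∃ e < m, ex e = x) ∧ s.arr 11 x = 0 then 1 else 0 := by
  classical
  refine (wp_forEdges (m := m) (fun i s' => Setup m K ex ey hd nx s' ∧ s'.arr 3 = s.arr 3 ∧
    s'.arr 11 = s.arr 11 ∧
    ∀ x, s'.arr 2 x = if (∃ e < i, ex e = x) ∧ s.arr 11 x = 0 then 1 else 0) (fun _ => 0) 20
      hs.reg2 ?_ le_rfl ?_).mono ?_
  · exact ⟨hs.setReg (by simp) (by simp), by simp, by simp, by simp [ho]⟩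
  · rintro i hi s' g2 g4 ⟨gs, g3, g11, g0⟩
    have k0 := gs.arr0
    have key : ∀ x, (∃ e ≤ i, ex e = x) ↔ (∃ e < i, ex e = x) ∨ ex i = x := by
      intro x
      constructor
      · rintro ⟨e, he, rfl⟩
        rcases he.lt_or_eq with he | rfl
        exacts [.inl ⟨e, he, rfl⟩, .inr rfl]
      · rintro (⟨e, he, rfl⟩ | rfl)
        exacts [⟨e, by omega, rfl⟩, ⟨i, by omega, rfl⟩]
    refine wp_cond (fun h => wp_store ?_) (fun h => wp_skip ?_) <;>
    simp [g4, k0, g11] at h ⊢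
    · refine ⟨g2, ?_, g3, fun x => ?_⟩
      · obtain ⟨k2, k3, k0, k1, ka, kb⟩ := gs
        constructor <;> simp [*]
      · simp only [Function.update_apply, g0, key]
        by_cases hx : x = ex i
        · subst hx; simp [h]
        · simp [hx, Ne.symm hx]
    · refine ⟨g2, gs.setReg (by simp) (by simp), g3, fun x => ?_⟩
      simp only [g0, key]
      by_cases hx : x = ex i
      · subst hx; simp [h]
      · simp [Ne.symm hx]
  · rintro t s' ⟨⟨h1, h2, h3, h4⟩, -, ht⟩
    exact ⟨by omega, h2, h4⟩

/-- The program is correct, and it takes `O(m (K + 1))` steps, where `K` is about the square root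
of `2 n`, with `n` the least of `m`, `|X|` and `|Y|`. -/
theorem wp_partitionProg {nX nY : ℕ} (s : State) (h0 : s.reg 0 = nX) (h1 : s.reg 1 = nY)
    (h2 : s.reg 2 = m) (a0 : s.arr 0 = ex) (a1 : s.arr 1 = ey)
    (ha : ∀ a, 2 ≤ a → s.arr a = fun _ => 0)
    (hX : ∀ e < m, ex e < nX) (hY : ∀ e < m, ey e < nY) :
    WP partitionProg s fun t s' => ∃ K mX mY vis par,
      Closed m ex ey mX mY vis (s'.arr 3) par ∧
      (∀ x, s'.arr 2 x = if (∃ e < m, ex e = x) ∧ vis x = 0 then 1 else 0) ∧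
      t ≤ 2000 * (m + 1) * (K + 1) ∧ K * K ≤ 2 * min m (min nX nY) + K := by
  refine wp_seq ((wp_boundProg s).mono ?_)
  rintro t₁ s₁ ⟨b1, b2, b3, b4, b5⟩
  refine wp_seq ((wp_listsProg (m := m) (ex := ex) s₁ (by rw [b3, h2]) (by rw [b2, a0])
    (by rw [b2, ha 4 (by simp)])).mono ?_)
  rintro t₂ s₂ ⟨c1, hL, c3, c4, c5⟩
  rw [h0, h1, h2] at b4 b5
  set K := s₁.reg 3 with hK
  have c6 : ∀ a, a ≠ 0 → a ≠ 1 → a ≠ 4 → a ≠ 5 → s₂.arr a = fun _ => 0 := by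
    intro a h0 h1 h4 h5
    rw [c5 a h4 h5, b2, ha a (by omega)]
  have hs : Setup m K ex ey (s₂.arr 4) (s₂.arr 5) s₂ := by
    refine ⟨c3, c4, ?_, ?_, rfl, rfl⟩
    · rw [c5 0 (by simp) (by simp), b2, a0]
    · rw [c5 1 (by simp) (by simp), b2, a1]
  refine wp_seq ((wp_auctionProg hL s₂ hs (fun a h => c6 a (by omega) (by omega) (by omega)
    (by omega))).mono ?_)
  rintro t₃ s₃ ⟨d1, ⟨d2, d3, d4⟩, hA, d5⟩
  refine wp_seq (wp_assign ?_)
  -- no matching has more than `N` edges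
  set N := (matched m ex (s₃.arr 6)).card + (K + 1) with hN
  have hbound : ∀ mX mY, Mates m ex ey mX mY → (matched m ex mX).card ≤ N := by
    intro mX mY hM
    have e1 := hA.mul_card_le hM
    have e2 := hA.mates.card_matched_le hX hY
    have e3 := hM.card_matched_le hX hY
    rcases Nat.eq_zero_or_pos K with hK0 | hK0
    · rw [hK0] at b4
      omega
    · by_contra hlt
      push Not at hlt
      have e4 : K * (N + 1) ≤ K * (matched m ex mX).card := Nat.mul_le_mul_left _ hlt
      rw [hN] at e4
      nlinarith
  refine wp_seq ((wp_loop (fun s' => Main m K ex ey (s₂.arr 4) (s₂.arr 5) s')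
    (fun s' => if s'.reg 12 = 0 then
      (N + 1 - (matched m ex (s'.arr 6)).card) * (400 * m + 300) else 0) ?_ (s := s₃.setReg 12 0)
      ?_).mono ?_)
  · intro s' hs' hb
    simp at hb
    refine (wp_roundProg hL s' hs' hb).mono ?_
    rintro t s'' ⟨e1, e2, e3⟩
    refine ⟨e1, ?_⟩
    have f1 := hbound _ _ hs'.mates
    have f2 := hbound _ _ e1.mates
    simp only [hb, if_true, Test.cost, Expr.cost]
    have f3 : N + 1 - (matched m ex (s'.arr 6)).card = N - (matched m ex (s'.arr 6)).card + 1 := by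
      omega
    split_ifs with h12
    · rcases e3 with e3 | e3
      · exact absurd h12 e3
      · rw [e3, f3, add_mul, Nat.add_sub_add_right]
        omega
    · rw [f3, add_mul]
      omega
  · refine ⟨d1.setReg (by simp) (by simp), ?_, hA.mates, ?_, ?_, by simp⟩
    · simp [d2, c6]
    · simp [d4, c6]
    · simp [d3, c6]
  · rintro t₄ s₄ ⟨e1, hb, e2⟩
    simp only [Test.Holds, Expr.val] at hb
    obtain ⟨par, hC⟩ := e1.ended hb
    refine (wp_outputProg s₄ e1.setup e1.out).mono ?_
    rintro t₅ s₅ ⟨f1, f2, f3⟩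
    refine ⟨K, _, _, _, par, by rw [f2]; exact hC, f3, ?_, ?_⟩
    · have hd : N + 1 - (matched m ex (s₃.arr 6)).card = K + 2 := by omega
      simp only [State.reg_setReg, State.arr_setReg, if_true, hd, Test.cost, Expr.cost] at e2 ⊢
      have g1 : t₄ ≤ (K + 2) * (400 * m + 300) + 4 := by
        simp at e2; omega
      rw [h2] at b1
      nlinarith [Nat.zero_le (m * K)]
    · by_cases hK0 : K = 0
      · simp [hK0]
      · exact b5 hK0

end Search

/-! ### Uniqueness of the partitions -/

section Uniqueness

variable {V : Type*} {G : SimpleGraph V} {X Y A B : Set V}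

theorem IsBipartition.mem_X (hb : IsBipartition G X Y) {x y : V} (h : G.Adj x y) (hy : y ∈ Y) :
    x ∈ X := by
  rcases hb.isBipartiteWith.mem_of_adj h with h' | h'
  · exact h'.1
  · exact absurd hy (Set.disjoint_left.1 hb.isBipartiteWith.disjoint h'.2)

theorem IsBipartition.mem_Y (hb : IsBipartition G X Y) {x y : V} (h : G.Adj x y) (hx : x ∈ X) :
    y ∈ Y := by
  rcases hb.isBipartiteWith.mem_of_adj h with h' | h'
  · exact h'.2
  · exact absurd h'.1 (Set.disjoint_left.1 hb.isBipartiteWith.disjoint hx)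

/-- In a `Y`-path-saturated graph, every `y` has a mate `f y`, and a neighbour that is either not
a mate of a vertex or the mate of a vertex of smaller rank. -/
theorem IsYPathSaturated.exists_mate (hb : IsBipartition G X Y) (hA : A ⊆ X) (hB : B ⊆ Y)
    (h : IsYPathSaturated G A B) : ∃ (f : V → V) (d : V → ℕ), Set.InjOn f B ∧
      ∀ y ∈ B, f y ∈ A ∧ G.Adj (f y) y ∧
        ∃ x ∈ A, G.Adj x y ∧ ∀ y' ∈ B, f y' = x → d y' < d y := by
  obtain ⟨k, hk, P, Q, rfl, hPd, rfl, hQd, hM⟩ := h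
  have : Nonempty (Fin k) := ⟨⟨0, hk⟩⟩
  choose hM hpar using hM
  choose M hM hMv using hM
  have h1 : ∀ y, y ∈ ⋃ i, Q i → ∃ i, y ∈ Q i := fun y hy => Set.mem_iUnion.1 hy
  choose! idx hidx using h1
  have h2 : ∀ y, ∃ x, y ∈ ⋃ i, Q i → (M (idx y)).Adj x y := by
    intro y
    by_cases hy : y ∈ ⋃ i, Q i
    · obtain ⟨x, hx, -⟩ := hM (idx y) (by rw [hMv]; exact .inr (hidx y hy))
      exact ⟨x, fun _ => hx.symm⟩
    · exact ⟨y, fun h => absurd h hy⟩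
  choose f hf using h2
  have hfP : ∀ y ∈ ⋃ i, Q i, f y ∈ P (idx y).succ := by
    intro y hy
    have h3 := (M (idx y)).edge_vert (hf y hy)
    rw [hMv] at h3
    refine h3.resolve_right fun h4 => ?_
    have hX := hb.mem_X (hf y hy).adj_sub (hB hy)
    exact Set.disjoint_left.1 hb.isBipartiteWith.disjoint hX (hB (Set.mem_iUnion.2 ⟨_, h4⟩))
  have hidxP : ∀ {x i j}, x ∈ P i → x ∈ P j → i = j := by
    intro x i j hi hj
    by_contra hne
    exact Set.disjoint_left.1 (hPd hne) hi hj
  refine ⟨f, fun y => idx y, ?_, fun y hy => ⟨Set.mem_iUnion.2 ⟨_, hfP y hy⟩,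
    (hf y hy).adj_sub, ?_⟩⟩
  · intro y hy y' hy' he
    have h3 := hfP y hy
    have h4 := hfP y' hy'
    rw [he] at h3
    have h5 := Fin.succ_injective _ (hidxP h3 h4)
    have h6 := hf y hy
    have h7 := hf y' hy'
    rw [he, h5] at h6
    obtain ⟨z, -, hz⟩ := hM (idx y') ((M (idx y')).edge_vert h7)
    exact (hz y h6).trans (hz y' h7).symm
  · obtain ⟨x, hx, hadj⟩ := hpar (idx y) y (hidx y hy)
    refine ⟨x, Set.mem_iUnion.2 ⟨_, hx⟩, hadj, ?_⟩
    rintro y' hy' rfl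
    have := hidxP (hfP y' hy') hx
    have := congrArg Fin.val this
    simp only [Fin.val_succ, Fin.val_castSucc] at this
    show (idx y' : ℕ) < idx y
    omega

/-- An envy-free matching saturates no vertex of `A` or `B` if `G[A, B]` is `Y`-path-saturated and
all neighbours of `A` are in `B`. By counting, the saturated vertices of `A` are exactly the mates
of the saturated vertices of `B`; but a saturated vertex of `B` of smallest rank has a neighbour in
`A`, which is saturated too, and not such a mate. -/
theorem IsEnvyFreeMatching.disjoint [Finite V] (hb : IsBipartition G X Y) (hA : A ⊆ X) (hB : B ⊆ Y)
    (hno : ∀ x ∈ A, ∀ y, G.Adj x y → y ∈ B) (h : IsYPathSaturated G A B) {M : G.Subgraph}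
    (hM : IsEnvyFreeMatching G X Y M) : Disjoint (A ∪ B) M.verts := by
  obtain ⟨f, d, hinj, hf⟩ := h.exists_mate hb hA hB
  obtain ⟨hM, henvy⟩ := hM
  have hsat : ∀ x ∈ A, ∀ y ∈ B, G.Adj x y → y ∈ M.verts → x ∈ M.verts := by
    intro x hx y hy hadj hyM
    by_contra hxM
    exact henvy x ⟨hA hx, hxM⟩ y ⟨hB hy, hyM⟩ hadj
  have h1 : f '' (B ∩ M.verts) ⊆ A ∩ M.verts := by
    rintro _ ⟨y, ⟨hy, hyM⟩, rfl⟩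
    exact ⟨(hf y hy).1, hsat _ (hf y hy).1 y hy (hf y hy).2.1 hyM⟩
  have h2 : (A ∩ M.verts).ncard ≤ (B ∩ M.verts).ncard := by
    choose! g hg using fun x (hx : x ∈ M.verts) => (hM hx).exists
    refine Set.ncard_le_ncard_of_injOn g (fun x hx => ?_) (fun x hx x' hx' he => ?_)
      (Set.toFinite _)
    · have := hg x hx.2
      exact ⟨hno x hx.1 _ this.adj_sub, M.edge_vert this.symm⟩
    · have e1 := hg x hx.2
      have e2 := hg x' hx'.2
      rw [he] at e1
      exact (hM (M.edge_vert e2.symm)).unique e1.symm e2.symm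
  have h3 : f '' (B ∩ M.verts) = A ∩ M.verts := by
    refine Set.eq_of_subset_of_ncard_le h1 ?_ (Set.toFinite _)
    rwa [(hinj.mono Set.inter_subset_left).ncard_image]
  have h4 : B ∩ M.verts = ∅ := by
    by_contra hne
    obtain ⟨y, ⟨hy, hyM⟩, hmin⟩ := Set.exists_min_image (B ∩ M.verts) d (Set.toFinite _)
      (Set.nonempty_iff_ne_empty.2 hne)
    obtain ⟨-, -, x, hx, hadj, hlt⟩ := hf y hy
    have : x ∈ f '' (B ∩ M.verts) := h3 ▸ ⟨hx, hsat x hx y hy hadj hyM⟩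
    obtain ⟨y', hy', rfl⟩ := this
    exact (hlt y' hy'.1 rfl).not_ge (hmin y' hy')
  rw [h4, Set.image_empty] at h3
  rw [Set.disjoint_iff_inter_eq_empty, Set.union_inter_distrib_right, ← h3, h4, Set.union_empty]

variable {p q : Parts V}

namespace IsStructurePartition

theorem isEnvyFreeMatching (hb : IsBipartition G X Y) (h : IsStructurePartition G X Y p)
    {M : G.Subgraph} (hM : IsSaturatingMatching G p.XL p.YL M) : IsEnvyFreeMatching G X Y M := by
  refine ⟨hM.1, fun x hx y hy hadj => ?_⟩
  have hxS : x ∈ p.XS := by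
    have := hx.1
    rw [← h.X_union] at this
    exact this.resolve_right fun h' => hx.2 (hM.2.2 h')
  have hyL : y ∈ p.YL := by
    refine (hM.2.1.1 hy.2 : y ∈ p.XL ∪ p.YL).resolve_left fun h' => ?_
    have : y ∈ X := h.X_union ▸ Or.inr h'
    exact Set.disjoint_left.1 hb.isBipartiteWith.disjoint this hy.1
  exact h.no_edge x hxS y hyL hadj

theorem mem_YS (hb : IsBipartition G X Y) (h : IsStructurePartition G X Y p) {x y : V}
    (hx : x ∈ p.XS) (hadj : G.Adj x y) : y ∈ p.YS := by
  have : y ∈ Y := hb.mem_Y hadj (h.X_union ▸ Or.inl hx)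
  rw [← h.Y_union] at this
  exact this.resolve_right fun h' => h.no_edge x hx y h' hadj

theorem le_between [Finite V] (hb : IsBipartition G X Y) (h : IsStructurePartition G X Y p)
    {M : G.Subgraph} (hM : IsEnvyFreeMatching G X Y M) : M ≤ between G p.XL p.YL := by
  have hd := hM.disjoint hb (h.X_union ▸ Set.subset_union_left)
    (h.Y_union ▸ Set.subset_union_left) (fun x hx y => h.mem_YS hb hx) h.pathSaturated
  have hv : M.verts ⊆ p.XL ∪ p.YL := by
    intro v hv
    have hn : v ∉ p.XS ∪ p.YS := fun h' => Set.disjoint_left.1 hd h' hv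
    have : v ∈ X ∪ Y := hb.union_eq ▸ Set.mem_univ v
    rw [← h.X_union, ← h.Y_union] at this
    simp only [Set.mem_union] at this hn ⊢
    tauto
  exact ⟨hv, fun a b hab => ⟨hv (M.edge_vert hab), hv (M.edge_vert hab.symm), hab.adj_sub⟩⟩

theorem XL_subset [Finite V] (hb : IsBipartition G X Y) (h : IsStructurePartition G X Y p)
    (h' : IsStructurePartition G X Y q) : p.XL ⊆ q.XL := by
  obtain ⟨M, hM⟩ := h.saturated
  have hle := h'.le_between hb (h.isEnvyFreeMatching hb hM)
  intro x hx
  refine (hle.1 (hM.2.2 hx) : x ∈ q.XL ∪ q.YL).resolve_right fun hxY => ?_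
  exact Set.disjoint_left.1 hb.isBipartiteWith.disjoint (h.X_union ▸ Or.inr hx : x ∈ X)
    (h'.Y_union ▸ Or.inr hxY : x ∈ Y)

theorem XS_eq (h : IsStructurePartition G X Y p) : p.XS = X \ p.XL := by
  rw [← h.X_union, Set.union_sdiff_right, h.X_disjoint.sdiff_eq_left]

theorem YL_eq (h : IsStructurePartition G X Y p) : p.YL = Y \ p.YS := by
  rw [← h.Y_union, Set.union_sdiff_left, h.Y_disjoint.symm.sdiff_eq_left]

theorem YS_eq (hb : IsBipartition G X Y) (h : IsStructurePartition G X Y p) :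
    p.YS = {y | ∃ x ∈ p.XS, G.Adj x y} := by
  ext y
  constructor
  · intro hy
    obtain ⟨f, d, -, hf⟩ := h.pathSaturated.exists_mate hb (h.X_union ▸ Set.subset_union_left)
      (h.Y_union ▸ Set.subset_union_left)
    exact ⟨f y, (hf y hy).1, (hf y hy).2.1⟩
  · rintro ⟨x, hx, hadj⟩
    exact h.mem_YS hb hx hadj

theorem unique [Finite V] (hb : IsBipartition G X Y) (h : IsStructurePartition G X Y p)
    (h' : IsStructurePartition G X Y q) : p = q := by
  have hXL : p.XL = q.XL := (h.XL_subset hb h').antisymm (h'.XL_subset hb h)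
  have hXS : p.XS = q.XS := by rw [h.XS_eq, h'.XS_eq, hXL]
  have hYS : p.YS = q.YS := by rw [h.YS_eq hb, h'.YS_eq hb, hXS]
  exact Parts.ext hXS hXL hYS (by rw [h.YL_eq, h'.YL_eq, hYS])

end IsStructurePartition

end Uniqueness

/-! ### Matchings and path-saturation from functions -/

section Construct

variable {V : Type*} {G : SimpleGraph V} {A B S : Set V} {f : V → V}

theorem exists_isMatching (hinj : Set.InjOn f S) (hadj : ∀ v ∈ S, G.Adj (f v) v)
    (hd : Disjoint S (f '' S)) : ∃ M : G.Subgraph, M.IsMatching ∧ M.verts = f '' S ∪ S := by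
  obtain ⟨M, hv, hM⟩ := SimpleGraph.Subgraph.IsMatching.exists_of_disjoint_sets_of_equiv hd
    (Equiv.Set.imageOfInjOn f S hinj) (fun v => (hadj v v.2).symm)
  exact ⟨M, hM, by rw [hv, Set.union_comm]⟩

theorem isXSaturated_of_mate (hinj : Set.InjOn f A) (hAB : Disjoint A B)
    (hf : ∀ v ∈ A, f v ∈ B ∧ G.Adj (f v) v) : IsXSaturated G A B := by
  have hsub : f '' A ⊆ B := by
    rintro _ ⟨v, hv, rfl⟩
    exact (hf v hv).1
  obtain ⟨M, hM, hv⟩ := exists_isMatching hinj (fun v hv => (hf v hv).2)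
    (hAB.mono_right hsub)
  have hvs : M.verts ⊆ A ∪ B := by
    rw [hv, Set.union_comm]
    exact Set.union_subset_union_right _ hsub
  exact ⟨M, hM, ⟨hvs, fun a b hab => ⟨hvs (M.edge_vert hab), hvs (M.edge_vert hab.symm),
    hab.adj_sub⟩⟩, by rw [hv]; exact Set.subset_union_right⟩

/-- Path-saturation from a mate `f y` of every `y` and a depth `d`, by which the blocks are
formed. -/
theorem isYPathSaturated_of_depth [Finite V] (d : V → ℕ) (hinj : Set.InjOn f B)
    (hAB : Disjoint A B) (hf : ∀ y ∈ B, f y ∈ A ∧ G.Adj (f y) y)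
    (hpar : ∀ y ∈ B, ∃ x ∈ A, G.Adj x y ∧ d (f y) = d x + 1)
    (hmate : ∀ x ∈ A, d x ≠ 0 → ∃ y ∈ B, f y = x) : IsYPathSaturated G A B := by
  obtain ⟨N, hN⟩ : ∃ N, ∀ x, d x ≤ N := by
    obtain ⟨N, hN⟩ := (Set.finite_range d).bddAbove
    exact ⟨N, fun x => hN ⟨x, rfl⟩⟩
  refine ⟨N + 1, by omega, fun i => {x ∈ A | d x = i}, fun i => {y ∈ B | d (f y) = i + 1},
    ?_, ?_, ?_, ?_, fun i => ⟨?_, ?_⟩⟩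
  · ext x
    simp only [Set.mem_iUnion, Set.mem_ofPred_eq]
    exact ⟨fun ⟨_, h, _⟩ => h, fun h => ⟨⟨d x, by have := hN x; omega⟩, h, rfl⟩⟩
  · intro i j hij
    refine Set.disjoint_left.2 fun x hx hx' => hij (Fin.ext ?_)
    exact hx.2.symm.trans hx'.2
  · ext y
    simp only [Set.mem_iUnion, Set.mem_ofPred_eq]
    refine ⟨fun ⟨_, h, _⟩ => h, fun h => ?_⟩
    obtain ⟨x, -, -, hx⟩ := hpar y h
    exact ⟨⟨d x, by have := hN (f y); omega⟩, h, hx⟩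
  · intro i j hij
    refine Set.disjoint_left.2 fun x hx hx' => hij (Fin.ext ?_)
    have := hx.2.symm.trans hx'.2
    omega
  · have himg : f '' {y ∈ B | d (f y) = i + 1} = {x ∈ A | d x = (i.succ : Fin (N + 2))} := by
      ext x
      simp only [Set.mem_image, Set.mem_ofPred_eq, Fin.val_succ]
      constructor
      · rintro ⟨y, ⟨hy, hd⟩, rfl⟩
        exact ⟨(hf y hy).1, hd⟩
      · rintro ⟨hx, hd⟩
        obtain ⟨y, hy, rfl⟩ := hmate x hx (by omega)
        exact ⟨y, ⟨hy, hd⟩, rfl⟩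
    beta_reduce
    rw [← himg]
    refine exists_isMatching (hinj.mono fun y hy => hy.1) (fun y hy => (hf y hy.1).2) ?_
    rw [himg]
    exact (hAB.mono (fun x hx => hx.1) (fun y hy => hy.1)).symm
  · rintro y ⟨hy, hd⟩
    obtain ⟨x, hx, hadj, hdx⟩ := hpar y hy
    exact ⟨x, ⟨hx, by simp only [Fin.val_castSucc]; omega⟩, hadj⟩

end Construct

/-! ### From the coded graph to the graph -/

section Transfer

variable {V : Type*} {G : SimpleGraph V} {X Y : Set V}

theorem exists_edgeListing [Finite V] (G : SimpleGraph V) (X Y : Set V) :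
    Nonempty (EdgeListing G X Y) := by
  refine ⟨⟨Finite.equivFinOfCardEq (Nat.card_coe_set_eq X),
    Finite.equivFinOfCardEq (Nat.card_coe_set_eq Y),
    (Set.toFinite {p : X × Y | G.Adj p.1 p.2}).toFinset.toList, Finset.nodup_toList _, ?_⟩⟩
  intro x y
  simp

theorem EdgeListing.length_le [Finite V] (hb : IsBipartition G X Y) (I : EdgeListing G X Y) :
    I.edges.length ≤ G.edgeSet.ncard := by
  classical
  have hinj : Function.Injective fun p : X × Y => s((p.1 : V), (p.2 : V)) := by
    rintro ⟨x, y⟩ ⟨x', y'⟩ h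
    have hd := Set.disjoint_left.1 hb.isBipartiteWith.disjoint
    rcases Sym2.eq_iff.1 h with ⟨h1, h2⟩ | ⟨h1, -⟩
    · exact Prod.ext (Subtype.ext h1) (Subtype.ext h2)
    · exact absurd y'.2 (h1 ▸ hd x.2)
  rw [← List.toFinset_card_of_nodup I.nodup, ← Finset.card_image_of_injective _ hinj,
    ← Set.ncard_coe_finset]
  refine Set.ncard_le_ncard ?_ (Set.toFinite _)
  intro z hz
  obtain ⟨p, hp, rfl⟩ := Finset.mem_image.1 (Finset.mem_coe.1 hz)
  exact (I.mem_edges p.1 p.2).1 (List.mem_toFinset.1 hp)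

theorem EdgeListing.arr_initial (I : EdgeListing G X Y) {e : ℕ} (he : e < I.edges.length) :
    I.initial.arr 0 e = I.numX (I.edges[e]).1 ∧ I.initial.arr 1 e = I.numY (I.edges[e]).2 := by
  simp [EdgeListing.initial, List.getElem?_eq_getElem he]

theorem EdgeListing.min_ne_zero (I : EdgeListing G X Y) (h : I.edges.length ≠ 0) :
    min X.ncard Y.ncard ≠ 0 := by
  have e : X × Y := I.edges[0]
  have h1 := (I.numX e.1).is_lt
  have h2 := (I.numY e.2).is_lt
  omega

theorem EdgeListing.edge_iff (I : EdgeListing G X Y) (a b : ℕ) :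
    Edge I.edges.length (I.initial.arr 0) (I.initial.arr 1) a b ↔
      ∃ (x : X) (y : Y), (I.numX x : ℕ) = a ∧ (I.numY y : ℕ) = b ∧ G.Adj x y := by
  constructor
  · rintro ⟨e, he, rfl, rfl⟩
    obtain ⟨h1, h2⟩ := I.arr_initial he
    exact ⟨_, _, h1.symm, h2.symm, (I.mem_edges _ _).1 (List.getElem_mem he)⟩
  · rintro ⟨x, y, rfl, rfl, h⟩
    obtain ⟨e, he, hxy⟩ := List.getElem_of_mem ((I.mem_edges x y).2 h)
    obtain ⟨h1, h2⟩ := I.arr_initial he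
    exact ⟨e, he, by rw [h1, hxy], by rw [h2, hxy]⟩

/-- The sets that have been reached by a closed forest form the structure partition. -/
theorem Closed.exists_partition [Finite V] (hb : IsBipartition G X Y) (I : EdgeListing G X Y)
    {mX mY vis vy par : ℕ → ℕ}
    (hC : Closed I.edges.length (I.initial.arr 0) (I.initial.arr 1) mX mY vis vy par) {s : State}
    (h3 : s.arr 3 = vy) (h2 : ∀ a, s.arr 2 a =
      if (∃ e < I.edges.length, I.initial.arr 0 e = a) ∧ vis a = 0 then 1 else 0) :
    ∃ p, IsStructurePartition G X Y p ∧ I.Exhibits s p := by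
  classical
  subst h3
  set vy := s.arr 3
  have hXY := Set.disjoint_left.1 hb.isBipartiteWith.disjoint
  have numX_inj : ∀ {x x' : X}, (I.numX x : ℕ) = I.numX x' → x = x' := fun h =>
    I.numX.injective (Fin.ext h)
  have numY_inj : ∀ {y y' : Y}, (I.numY y : ℕ) = I.numY y' → y = y' := fun h =>
    I.numY.injective (Fin.ext h)
  have hadj : ∀ {x : X} {y : Y}, G.Adj x y → ∃ e < I.edges.length,
      I.initial.arr 0 e = I.numX x ∧ I.initial.arr 1 e = I.numY y := fun {x y} h =>
    (I.edge_iff _ _).2 ⟨x, y, rfl, rfl, h⟩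
  have hmem : ∀ {x : X} {y : Y},
      Edge I.edges.length (I.initial.arr 0) (I.initial.arr 1) (I.numX x) (I.numY y) →
      G.Adj x y := by
    intro x y h
    obtain ⟨x', y', hx, hy, h⟩ := (I.edge_iff _ _).1 h
    rwa [← numX_inj hx, ← numY_inj hy]
  obtain ⟨d, hd0, hd1⟩ := hC.toForest.exists_depth
  set XL : Set V := {v | ∃ h : v ∈ X, s.arr 2 (I.numX ⟨v, h⟩) = 1} with hXL
  set YS : Set V := {v | ∃ h : v ∈ Y, vy (I.numY ⟨v, h⟩) ≠ 0} with hYS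
  have memXL : ∀ x : X, (x : V) ∈ XL ↔ s.arr 2 (I.numX x) = 1 := fun x =>
    ⟨fun ⟨_, h⟩ => h, fun h => ⟨x.2, h⟩⟩
  have memYS : ∀ y : Y, (y : V) ∈ YS ↔ vy (I.numY y) ≠ 0 := fun y =>
    ⟨fun ⟨_, h⟩ => h, fun h => ⟨y.2, h⟩⟩
  have hXLX : XL ⊆ X := fun v ⟨h, _⟩ => h
  have hYSY : YS ⊆ Y := fun v ⟨h, _⟩ => h
  -- a vertex of `X` is in `X_L` if it is not isolated and has not been reached
  have notXL : ∀ {x : X} {y : Y}, (x : V) ∉ XL → G.Adj x y → vis (I.numX x) ≠ 0 := by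
    intro x y hx h hv
    obtain ⟨e, he, hex, -⟩ := hadj h
    exact hx ((memXL x).2 (by rw [h2, if_pos ⟨⟨e, he, hex⟩, hv⟩]))
  have inXL : ∀ {x : X}, vis (I.numX x) ≠ 0 → (x : V) ∉ XL := by
    intro x hv hx
    rw [memXL, h2, if_neg (fun h => hv h.2)] at hx
    exact zero_ne_one hx
  -- mates of the vertices of `Y_S`
  have hmate : ∀ v, ∃ w, ∀ h : v ∈ YS, ∃ x : X, (x : V) = w ∧
      mX (I.numX x) = I.numY ⟨v, hYSY h⟩ + 1 := by
    intro v
    by_cases h : v ∈ YS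
    · obtain ⟨a, ha⟩ := Nat.exists_eq_succ_of_ne_zero (hC.matched _ ((memYS ⟨v, hYSY h⟩).1 h))
      have ha' := (hC.iff _ _).2 ha
      obtain ⟨x, y, rfl, hy, -⟩ := (I.edge_iff _ _).1 (hC.edge _ _ ha')
      exact ⟨x, fun _ => ⟨x, rfl, ha'⟩⟩
    · exact ⟨v, fun h' => absurd h' h⟩
  choose f hf using hmate
  -- mates of the vertices of `X_L`
  have hmate' : ∀ v, ∃ w, ∀ h : v ∈ XL, ∃ y : Y, (y : V) = w ∧ vy (I.numY y) = 0 ∧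
      mX (I.numX ⟨v, hXLX h⟩) = I.numY y + 1 := by
    intro v
    by_cases h : v ∈ XL
    · have hx := (memXL ⟨v, hXLX h⟩).1 h
      rw [h2] at hx
      split_ifs at hx with hx'
      obtain ⟨hact, hvis⟩ := hx'
      have hne : mX (I.numX ⟨v, hXLX h⟩) ≠ 0 := fun h0 =>
        hC.root _ (mem_active.2 hact) h0 hvis
      obtain ⟨b, hb'⟩ := Nat.exists_eq_succ_of_ne_zero hne
      obtain ⟨x, y, hx, rfl, -⟩ := (I.edge_iff _ _).1 (hC.edge _ _ hb')
      refine ⟨y, fun _ => ⟨y, rfl, ?_, hb'⟩⟩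
      by_contra hy
      have := hC.lt _ _ hy hb'
      omega
    · exact ⟨v, fun h' => absurd h' h⟩
  choose g hg using hmate'
  refine ⟨⟨X \ XL, XL, YS, Y \ YS⟩, ⟨Set.sdiff_union_of_subset hXLX, Set.disjoint_sdiff_left,
    Set.union_sdiff_cancel hYSY, Set.disjoint_sdiff_right, ?_, ?_, ?_⟩, ?_, ?_⟩
  · rintro x ⟨hx, hxL⟩ y ⟨hy, hyS⟩ h
    obtain ⟨e, he, hex, hey⟩ := hadj (x := ⟨x, hx⟩) (y := ⟨y, hy⟩) h
    have := hC.closed e he (by rw [hex]; exact notXL (x := ⟨x, hx⟩) (y := ⟨y, hy⟩) hxL h)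
    rw [hey] at this
    exact hyS ((memYS ⟨y, hy⟩).2 this)
  · refine isYPathSaturated_of_depth (f := f)
      (fun v => if h : v ∈ X then d (I.numX ⟨v, h⟩) else 0) ?_ ?_ ?_ ?_ ?_
    · intro v hv v' hv' he
      obtain ⟨x, hx, h1⟩ := hf v hv
      obtain ⟨x', hx', h1'⟩ := hf v' hv'
      obtain rfl : x = x' := Subtype.ext (by rw [hx, hx', he])
      have := numY_inj (Nat.succ_injective (h1.symm.trans h1'))
      exact congrArg Subtype.val this
    · exact Set.disjoint_left.2 fun v hv hv' => hXY hv.1 (hYSY hv')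
    · intro v hv
      obtain ⟨x, hx, h1⟩ := hf v hv
      rw [← hx]
      have hvy := (memYS ⟨v, hYSY hv⟩).1 hv
      have := hC.lt _ _ hvy h1
      exact ⟨⟨x.2, inXL (by omega)⟩, hmem (y := ⟨v, hYSY hv⟩) (hC.edge _ _ h1)⟩
    · intro v hv
      obtain ⟨x, hx, h1⟩ := hf v hv
      have hvy := (memYS ⟨v, hYSY hv⟩).1 hv
      obtain ⟨z, y, hz, hy, hzy⟩ := (I.edge_iff _ _).1 (hC.edge_par _ hvy)
      obtain rfl := numY_inj hy
      refine ⟨z, ⟨z.2, inXL (by rw [hz]; exact hC.vis_par _ hvy)⟩, hzy, ?_⟩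
      rw [← hx]
      simp only [x.2, z.2, dif_pos, Subtype.coe_eta]
      rw [hd1 _ _ hvy h1, hz]
    · rintro v ⟨hv, hvL⟩ hdv
      simp only [hv, dif_pos] at hdv
      have hm : mX (I.numX ⟨v, hv⟩) ≠ 0 := fun h0 => hdv (hd0 _ h0)
      obtain ⟨b, hb'⟩ := Nat.exists_eq_succ_of_ne_zero hm
      obtain ⟨x, y, hx, rfl, hxy⟩ := (I.edge_iff _ _).1 (hC.edge _ _ hb')
      obtain rfl := numX_inj hx
      have hy : (y : V) ∈ YS :=
        (memYS y).2 (hC.mate _ _ (notXL hvL hxy) hb')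
      refine ⟨y, hy, ?_⟩
      obtain ⟨x', hx', h1⟩ := hf y hy
      rw [← hx']
      have := numX_inj (hC.mX_inj h1 hb')
      rw [this]
  · refine isXSaturated_of_mate (f := g) ?_ ?_ ?_
    · intro v hv v' hv' he
      obtain ⟨y, hy, -, h1⟩ := hg v hv
      obtain ⟨y', hy', -, h1'⟩ := hg v' hv'
      obtain rfl : y = y' := Subtype.ext (by rw [hy, hy', he])
      exact congrArg Subtype.val (numX_inj (hC.mX_inj h1 h1'))
    · exact Set.disjoint_left.2 fun v hv hv' => hXY (hXLX hv) hv'.1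
    · intro v hv
      obtain ⟨y, hy, h0, h1⟩ := hg v hv
      rw [← hy]
      exact ⟨⟨y.2, fun h => (memYS y).1 h h0⟩, (hmem (x := ⟨v, hXLX hv⟩) (hC.edge _ _ h1)).symm⟩
  · intro x
    refine ⟨(memXL x).1, fun hx => ?_⟩
    have h01 : s.arr 2 (I.numX x) = 0 ∨ s.arr 2 (I.numX x) = 1 := by
      rw [h2]
      split_ifs
      exacts [.inr rfl, .inl rfl]
    exact h01.resolve_right fun h => hx.2 ((memXL x).2 h)
  · intro y
    refine ⟨fun h => ?_, fun h => ?_⟩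
    · have := (memYS y).1 h
      have := hC.vy_le (I.numY y)
      show vy _ = 1
      omega
    · by_contra hne
      exact h.2 ((memYS y).2 hne)

theorem EdgeListing.runs_partitionProg [Finite V] (hb : IsBipartition G X Y)
    (I : EdgeListing G X Y) : ∃ t s p K, Runs partitionProg I.initial t s ∧
      IsStructurePartition G X Y p ∧ I.Exhibits s p ∧ t ≤ 2000 * (I.edges.length + 1) * (K + 1) ∧
      K * K ≤ 2 * min I.edges.length (min X.ncard Y.ncard) + K := by
  obtain ⟨t, s, hr, K, mX, mY, vis, par, hC, h2, ht, hK⟩ := wp_partitionProg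
    (m := I.edges.length) (ex := I.initial.arr 0) (ey := I.initial.arr 1)
    (nX := X.ncard) (nY := Y.ncard) I.initial
    (by simp [EdgeListing.initial]) (by simp [EdgeListing.initial]) (by simp [EdgeListing.initial])
    rfl rfl
    (by
      intro a ha
      funext i
      have h0 : a ≠ 0 := by omega
      have h1 : a ≠ 1 := by omega
      simp only [EdgeListing.initial, h0, h1, if_false]
      cases I.edges[i]? <;> rfl)
    (by intro e he; rw [(I.arr_initial he).1]; exact Fin.is_lt _)
    (by intro e he; rw [(I.arr_initial he).2]; exact Fin.is_lt _)
  obtain ⟨p, hp, hE⟩ := hC.exists_partition hb I rfl h2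
  exact ⟨t, s, p, K, hr, hp, hE, ht, hK⟩

theorem existsUnique_partition [Finite V] (hb : IsBipartition G X Y) :
    ∃! p, IsStructurePartition G X Y p := by
  obtain ⟨I⟩ := exists_edgeListing G X Y
  obtain ⟨-, -, p, -, -, hp, -⟩ := I.runs_partitionProg hb
  exact ⟨p, hp, fun q hq => hq.unique hb hp⟩

/-- From the number `K` of rounds to the square root: `K ≤ 3 √n` unless there are no edges, in which
case the number of steps is bounded. -/
theorem time_bound {t m K n : ℕ} (hn : m ≠ 0 → n ≠ 0) (ht : t ≤ 2000 * (m + 1) * (K + 1))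
    (hK : K * K ≤ 2 * min m n + K) : (t : ℝ) ≤ 16000 * ((m : ℝ) * √(n : ℝ) + 1) := by
  have h0 := Real.sqrt_nonneg (n : ℝ)
  have hr := Real.mul_self_sqrt (Nat.cast_nonneg (α := ℝ) n)
  have ht' : (t : ℝ) ≤ 2000 * (m + 1) * (K + 1) := by exact_mod_cast ht
  by_cases hm0 : m = 0
  · subst hm0
    rw [Nat.zero_min] at hK
    have hK1 : K ≤ 1 := by nlinarith
    have ht1 : (t : ℝ) ≤ 16000 := by exact_mod_cast (by omega : t ≤ 16000)
    simpa using ht1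
  · have hm : (1 : ℝ) ≤ m := by exact_mod_cast (by omega : 1 ≤ m)
    have hn0 := hn hm0
    have hn : (1 : ℝ) ≤ √(n : ℝ) := by
      rw [Real.one_le_sqrt]
      exact_mod_cast (by omega : 1 ≤ n)
    have hK' : (K : ℝ) * K ≤ 2 * (√(n : ℝ) * √(n : ℝ)) + K := by
      rw [hr]
      have : K * K ≤ 2 * n + K := by omega
      exact_mod_cast this
    have hK3 : (K : ℝ) ≤ 3 * √(n : ℝ) := by
      by_contra hlt
      push Not at hlt
      nlinarith
    nlinarith [mul_le_mul hm hn zero_le_one (by linarith)]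

end Transfer

end EnvyFree

theorem theorem1 :
    (∀ {V : Type*} [Finite V] (G : SimpleGraph V) (X Y : Set V),
      EnvyFree.IsBipartition G X Y →
        (∃! p : EnvyFree.Parts V, EnvyFree.IsStructurePartition G X Y p) ∧
        ∀ p : EnvyFree.Parts V, EnvyFree.IsStructurePartition G X Y p →
          (∃ M : G.Subgraph, EnvyFree.IsSaturatingMatching G p.XL p.YL M) ∧
          (∀ M : G.Subgraph, EnvyFree.IsSaturatingMatching G p.XL p.YL M →
            EnvyFree.IsEnvyFreeMatching G X Y M) ∧
          (∀ M : G.Subgraph, EnvyFree.IsEnvyFreeMatching G X Y M →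
            M ≤ EnvyFree.between G p.XL p.YL)) ∧
    (∃ (prog : EnvyFree.Program) (C : ℝ),
      ∀ {V : Type*} [Finite V] (G : SimpleGraph V) (X Y : Set V),
        EnvyFree.IsBipartition G X Y →
        ∀ p : EnvyFree.Parts V, EnvyFree.IsStructurePartition G X Y p →
        ∀ I : EnvyFree.EdgeListing G X Y,
          ∃ (t : ℕ) (s : EnvyFree.State),
            EnvyFree.Runs prog I.initial t s ∧ I.Exhibits s p ∧
            (t : ℝ) ≤ C * ((G.edgeSet.ncard : ℝ) * √((min X.ncard Y.ncard : ℕ) : ℝ) + 1)) := by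
  refine ⟨fun G X Y hb => ⟨EnvyFree.existsUnique_partition hb, fun p hp => ⟨hp.saturated,
    fun M hM => hp.isEnvyFreeMatching hb hM, fun M hM => hp.le_between hb hM⟩⟩,
    EnvyFree.partitionProg, 16000, fun G X Y hb p hp I => ?_⟩
  obtain ⟨t, s, q, K, hr, hq, hE, ht, hK⟩ := I.runs_partitionProg hb
  obtain rfl := hp.unique hb hq
  refine ⟨t, s, hr, hE, (EnvyFree.time_bound I.min_ne_zero ht hK).trans ?_⟩
  have : (I.edges.length : ℝ) ≤ G.edgeSet.ncard := by exact_mod_cast I.length_le hb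
  gcongr
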